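/- Let $n>1$, let $q$ be a power of $2$, and let $\mathcal P=\mathcal Q(2n,q)$ be a parabolic quadric in $\mathrm{PG}(2n,q)$, i.e. the zero set of a non-singular quadratic form in $2n+1$ variables. Let $N$ be its nucleus, i.e. the point $N\notin\mathcal P$ such that every line through $N$ contains exactly one point of $\mathcal P$. Let $\pi$ be a singular hyperplane of $\mathcal P$ with vertex the point $P$: $\pi\cap\mathcal P$ has as many points as a cone $P\mathcal Q(2n-2,q)$, namely $\frac{q^{2n-1}-1}{q-1}$, and is a cone with vertex $P$. A parabolic quasi-quadric with nucleus $M$ in $\mathrm{PG}(2m,q)$, $m\ge 1$, is a set $\mathcal S$ of $\frac{q^{2m}-1}{q-1}$ points such that every hyperplane not through $M$ contains $|\mathcal Q^-(2m-1,q)|=\frac{(q^m+1)(q^{m-1}-1)}{q-1}$ or $|\mathcal Q^+(2m-1,q)|=\frac{(q^m-1)(q^{m-1}+1)}{q-1}$ points of $\mathcal S$, and every line through $M$ contains exactly one point of $\mathcal S$. Suppose that $\mathcal P'$ is a parabolic quasi-quadric with nucleus $N'$ in $\mathrm{PG}(2n,q)$ that is obtained by switching $\mathcal P$ in $\pi$,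 i.e. $\mathcal P'=(\mathcal P\setminus R)\cup R'$ for some sets $R,R'$ of points of $\pi$. Then one of the following holds. 1. $N'=N$, and $\mathcal P'\cap\pi$ is the point set of a cone with vertex $P$. For every hyperplane $\mu$ of $\pi$ that contains $N$ but not $P$, the base $\mathcal P'\cap\mu$ of this cone in $\mu$ is a parabolic quasi-quadric in $\mu\cong\mathrm{PG}(2n-2,q)$ with nucleus $N$. 2. $N'=P$, and $\mathcal P'\cap\pi$ is the point set of a cone with vertex $N$. For every hyperplane $\mu$ of $\pi$ that contains $P$ but not $N$, the base $\mathcal P'\cap\mu$ of this cone in $\mu$ is a parabolic quasi-quadric in $\mu\cong\mathrm{PG}(2n-2,q)$ with nucleus $P$. -/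

import Mathlib

open scoped LinearAlgebra.Projectivization

namespace QuasiQuadric

section

variable {K V : Type*} [Field K] [AddCommGroup V] [Module K V]

/-- The set of points of the subspace of the projective space `ℙ K V` that is given by the
linear subspace `W` of `V`. -/
def pts (W : Submodule K V) : Set (ℙ K V) := {p | p.submodule ≤ W}

/-- `μ` is a hyperplane of the (projective) subspace `π`. -/
def IsHyperplaneOf (μ π : Submodule K V) : Prop :=
  μ ≤ π ∧ Module.finrank K μ + 1 = Module.finrank K π

/-- The quadric with equation `Q = 0`, as a set of points. -/
def quadric (Q : QuadraticForm K V) : Set (ℙ K V) :=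
  {p | ∀ v ∈ p.submodule, Q v = 0}

/-- `S` is (the point set of) a parabolic quadric `Q(2n, q)` in `ℙ K V = PG(2n, q)`: the zero set
of a non-singular quadratic form in `2n + 1` variables. Here `Q.radical` consists of the vectors
`v` with `Q v = 0` that are orthogonal to all vectors for the polar form of `Q`. -/
def IsParabolicQuadric (n : ℕ) (S : Set (ℙ K V)) : Prop :=
  Module.finrank K V = 2 * n + 1 ∧ ∃ Q : QuadraticForm K V, Q.radical = ⊥ ∧ S = quadric Q

/-- Every line of the subspace `W` through the point `N` contains exactly one point of `S`. -/
def OnlyTangentsThrough (W : Submodule K V) (S : Set (ℙ K V)) (N : ℙ K V) : Prop :=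
  ∀ L : Submodule K V, L ≤ W → Module.finrank K L = 2 → N ∈ pts L → ∃! p : ℙ K V, p ∈ S ∩ pts L

/-- `N` is a nucleus of the point set `S` of `ℙ K V`. -/
def IsNucleus (S : Set (ℙ K V)) (N : ℙ K V) : Prop :=
  N ∉ S ∧ OnlyTangentsThrough ⊤ S N

/-- The cone with vertex `P` and base `B`: the point `P` together with the points of the lines
that join `P` to the points of `B`. -/
def cone (P : ℙ K V) (B : Set (ℙ K V)) : Set (ℙ K V) :=
  {P} ∪ {R | ∃ X ∈ B, R.submodule ≤ P.submodule ⊔ X.submodule}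

/-- `B` is the base in `μ` of the cone `S` with vertex `P`, the cone being contained in `π` and
`μ` being a hyperplane of `π` that does not contain `P`. -/
structure IsConeWithBase (π : Submodule K V) (S : Set (ℙ K V)) (P : ℙ K V)
    (μ : Submodule K V) (B : Set (ℙ K V)) : Prop where
  vertex_mem : P ∈ pts π
  hyperplane : IsHyperplaneOf μ π
  vertex_notMem : P ∉ pts μ
  base_subset : B ⊆ pts μ
  eq_cone : S = cone P B

/-- `S` is the point set of a cone in `π` with vertex the point `P`. -/
def IsCone (π : Submodule K V) (S : Set (ℙ K V)) (P : ℙ K V) : Prop :=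
  ∃ μ B, IsConeWithBase π S P μ B

/-- The number `(q^(2m) - 1) / (q - 1)` of points of a parabolic quadric `Q(2m, q)`. -/
def parabolicCard (q m : ℕ) : ℕ := (q ^ (2 * m) - 1) / (q - 1)

/-- The number of points of an elliptic quadric `Q⁻(2m-1, q)`, where `1 ≤ m`. -/
def ellipticCard (q m : ℕ) : ℕ := (q ^ m + 1) * (q ^ (m - 1) - 1) / (q - 1)

/-- The number of points of a hyperbolic quadric `Q⁺(2m-1, q)`, where `1 ≤ m`. -/
def hyperbolicCard (q m : ℕ) : ℕ := (q ^ m - 1) * (q ^ (m - 1) + 1) / (q - 1)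

/-- The number of points of a cone with vertex a point over a parabolic quadric `Q(2m-2, q)`,
where `1 ≤ m`: the vertex, and `q` further points for each point of the base. -/
def singularCard (q m : ℕ) : ℕ := q * parabolicCard q (m - 1) + 1

/-- `S` is a parabolic quasi-quadric with nucleus `N` in the projective space of the points of
`W`, where this space is a `PG(2m, q)`. -/
structure IsParabolicQuasiQuadricWithNucleus (m : ℕ) (W : Submodule K V)
    (S : Set (ℙ K V)) (N : ℙ K V) : Prop where
  finrank_eq : Module.finrank K W = 2 * m + 1
  subset : S ⊆ pts W
  nucleus_mem : N ∈ pts W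
  card_eq : S.ncard = parabolicCard (Nat.card K) m
  card_hyperplane : ∀ H : Submodule K V, IsHyperplaneOf H W → N ∉ pts H →
    (S ∩ pts H).ncard = ellipticCard (Nat.card K) m ∨
      (S ∩ pts H).ncard = hyperbolicCard (Nat.card K) m
  tangent : OnlyTangentsThrough W S N

/-- `π` is a singular hyperplane of the point set `S` of `ℙ K V = PG(2n, q)`, with vertex `P`:
it meets `S` in as many points as there are in a cone with vertex a point over a `Q(2n-2, q)`,
and it meets `S` in a cone with vertex `P`. -/
structure IsSingularHyperplaneWithVertex (n : ℕ) (S : Set (ℙ K V)) (π : Submodule K V)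
    (P : ℙ K V) : Prop where
  hyperplane : IsHyperplaneOf π ⊤
  card_eq : (S ∩ pts π).ncard = singularCard (Nat.card K) n
  isCone : IsCone π (S ∩ pts π) P

/-- `S'` is obtained by switching `S` in `π`: a set `R` of points of `π` is replaced by a
set `R'` of points of `π`. -/
def IsSwitching (S : Set (ℙ K V)) (π : Submodule K V) (S' : Set (ℙ K V)) : Prop :=
  ∃ R R' : Set (ℙ K V), R ⊆ pts π ∧ R' ⊆ pts π ∧ S' = (S \ R) ∪ R'

end

end QuasiQuadric

/-! Let `B` be the polar form of `Q`, let `p` and `b` represent `P` and `N`, and put `φ = B(p, ·)`.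
A singular hyperplane is the orthogonal space of its vertex
(`IsSingularHyperplaneWithVertex.eq_ker`), so `π = ker φ`, and all that switching leaves is that
`S'` agrees with `Q = 0` where `φ ≠ 0`.

If `N'` were off `π`, counting in planes would make `N` a second nucleus of `S'`, which the
hyperplane sizes exclude. So `N'` lies in `π`, and a line through `N'` leaving `π` has exactly one
singular point off `π`; this forces `N' = N` or `N' = P` (`nucleus_mem_span`).

Let `a` represent `N'` and `c` the other of the two points. If `f` vanishes at neither, the
hyperplanes `f = tφ` share their trace on `π`. Two of them have different numbers of points off `π`,
with known sum (`exists_level_pair`), so one is of elliptic and one of hyperbolic size, and adding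
the sizes gives the size of the trace. If `f a = 0` and `f c ≠ 0`, tangents through `a` give the
same size. Thus all hyperplanes missing `c` meet `S' ∩ π` equally often, and a Radon-type inversion
(`ncard_inter_span_eq`) shows that `S' ∩ π` is a cone with vertex `c`. Hyperplanes through `c` then
give the sizes of the hyperplane sections of the bases (`isCone_and_bases`).

The differing numbers come from a quadratic character sum in characteristic two whose square is a
sum of nonnegative terms, one of them positive (`charSum_ne_zero`). -/

namespace QuasiQuadric

/-! ### Point sets as sets of vectors, and counting along lines. -/

section Vectors

variable {K V : Type*} [Field K] [AddCommGroup V] [Module K V]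

/-- The set of nonzero vectors that represent the points of `T`. -/
def vec (T : Set (ℙ K V)) : Set V := {v | ∃ h : v ≠ 0, Projectivization.mk K v h ∈ T}

lemma mk_mem_pts {v : V} (hv : v ≠ 0) {W : Submodule K V} :
    Projectivization.mk K v hv ∈ pts W ↔ v ∈ W := by
  simp [pts, Projectivization.submodule_mk]

lemma ne_zero_of_mem_vec {T : Set (ℙ K V)} {v : V} (h : v ∈ vec T) : v ≠ 0 := h.1

lemma mk_mem_iff_mem_vec {T : Set (ℙ K V)} {v : V} (hv : v ≠ 0) :
    Projectivization.mk K v hv ∈ T ↔ v ∈ vec T :=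
  ⟨fun h => ⟨hv, h⟩, fun h => h.2⟩

lemma smul_mem_vec {T : Set (ℙ K V)} {c : K} (hc : c ≠ 0) {v : V} :
    c • v ∈ vec T ↔ v ∈ vec T := by
  constructor
  · rintro ⟨h, hT⟩
    have hv : v ≠ 0 := fun h0 => h (by simp [h0])
    refine ⟨hv, ?_⟩
    rwa [show Projectivization.mk K v hv = Projectivization.mk K (c • v) h from
      ((Projectivization.mk_eq_mk_iff' K _ _ _ _).2 ⟨c⁻¹, by simp [smul_smul, hc]⟩)]
  · rintro ⟨h, hT⟩
    refine ⟨smul_ne_zero hc h, ?_⟩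
    rwa [show Projectivization.mk K (c • v) (smul_ne_zero hc h) = Projectivization.mk K v h from
      ((Projectivization.mk_eq_mk_iff' K _ _ _ _).2 ⟨c, rfl⟩)]

lemma vec_inter_pts (T : Set (ℙ K V)) (W : Submodule K V) :
    vec (T ∩ pts W) = vec T ∩ W := by
  ext v
  constructor
  · rintro ⟨h, h1, h2⟩
    exact ⟨⟨h, h1⟩, (mk_mem_pts h).1 h2⟩
  · rintro ⟨⟨h, h1⟩, h2⟩
    exact ⟨h, h1, (mk_mem_pts h).2 h2⟩

lemma vec_injective : Function.Injective (vec : Set (ℙ K V) → Set V) := by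
  intro S T h
  ext x
  induction x using Projectivization.ind with
  | h v hv => rw [mk_mem_iff_mem_vec, mk_mem_iff_mem_vec, h]

lemma vec_quadric (Q : QuadraticForm K V) : vec (quadric Q) = {v | v ≠ 0 ∧ Q v = 0} := by
  ext v
  constructor
  · rintro ⟨h, h1⟩
    exact ⟨h, h1 v (by simp [Projectivization.submodule_mk])⟩
  · rintro ⟨h, h1⟩
    refine ⟨h, fun w hw => ?_⟩
    rw [Projectivization.submodule_mk, Submodule.mem_span_singleton] at hw
    obtain ⟨c, rfl⟩ := hw
    simp [QuadraticMap.map_smul, h1]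

lemma mem_cone_iff {p x : V} (hp : p ≠ 0) (hx : x ≠ 0) (B : Set (ℙ K V)) :
    x ∈ vec (cone (Projectivization.mk K p hp) B) ↔
      x ∈ K ∙ p ∨ ∃ y ∈ vec B, ∃ t : K, ∃ s : K, x = t • p + s • y := by
  constructor
  · rintro ⟨_, h | ⟨X, hX, h⟩⟩
    · left
      rw [Set.mem_singleton_iff, Projectivization.mk_eq_mk_iff'] at h
      exact Submodule.mem_span_singleton.2 h
    · right
      induction X using Projectivization.ind with
      | h y hy =>
        refine ⟨y, ⟨hy, hX⟩, ?_⟩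
        rw [Projectivization.submodule_mk, Projectivization.submodule_mk,
          Projectivization.submodule_mk, Submodule.span_singleton_le_iff_mem] at h
        obtain ⟨a, ha, b, hb, rfl⟩ := Submodule.mem_sup.1 h
        obtain ⟨t, rfl⟩ := Submodule.mem_span_singleton.1 ha
        obtain ⟨s, rfl⟩ := Submodule.mem_span_singleton.1 hb
        exact ⟨t, s, rfl⟩
  · intro h
    refine ⟨hx, ?_⟩
    rcases h with h | ⟨y, ⟨hy, hyB⟩, t, s, rfl⟩
    · left
      rw [Set.mem_singleton_iff, Projectivization.mk_eq_mk_iff']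
      exact Submodule.mem_span_singleton.1 h
    · right
      refine ⟨_, hyB, ?_⟩
      rw [Projectivization.submodule_mk, Projectivization.submodule_mk,
          Projectivization.submodule_mk, Submodule.span_singleton_le_iff_mem]
      exact Submodule.add_mem_sup (Submodule.smul_mem _ _ (Submodule.mem_span_singleton_self _))
        (Submodule.smul_mem _ _ (Submodule.mem_span_singleton_self _))

/-- A point outside `T` all of whose lines are tangent to `T`, in terms of vectors. -/
lemma OnlyTangentsThrough.existsUnique {W : Submodule K V} {T : Set (ℙ K V)} {a : V}
    {ha : a ≠ 0} (h : OnlyTangentsThrough W T (Projectivization.mk K a ha)) (haW : a ∈ W)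
    (haT : a ∉ vec T) {w : V} (hw : w ∈ W) (hwa : w ∉ K ∙ a) : ∃! t : K, w + t • a ∈ vec T := by
  have hli : LinearIndependent K ![a, w] := by
    rw [LinearIndependent.pair_iff' ha]
    exact fun c hc => hwa (Submodule.mem_span_singleton.2 ⟨c, hc⟩)
  have hfin : Module.finrank K (Submodule.span K ({a, w} : Set V)) = 2 := by
    have := finrank_span_eq_card hli
    rwa [Matrix.range_cons, Matrix.range_cons, Matrix.range_empty, Set.union_empty,
      Set.singleton_union, Fintype.card_fin] at this
  obtain ⟨X, ⟨hXT, hXL⟩, huniq⟩ := h (Submodule.span K ({a, w} : Set V))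
    (Submodule.span_le.2 (by rintro x (rfl | rfl) <;> assumption)) hfin
    ((mk_mem_pts ha).2 (Submodule.subset_span (by simp)))
  have hne (t : K) : w + t • a ≠ 0 := fun h0 =>
    hwa (Submodule.mem_span_singleton.2 ⟨-t, by
      rw [neg_smul]; exact (eq_neg_of_add_eq_zero_left h0).symm⟩)
  induction X using Projectivization.ind with
  | h x hx =>
    rw [mk_mem_pts, Submodule.mem_span_pair] at hXL
    obtain ⟨s, u, rfl⟩ := hXL
    -- Otherwise the tangent point would be the point of `a`, which is not in `T`.
    have hu : u ≠ 0 := by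
      rintro rfl
      have h1 : s • a ∈ vec T := by simpa using (mk_mem_iff_mem_vec hx).1 hXT
      have hs : s ≠ 0 := fun h0 => ne_zero_of_mem_vec h1 (by simp [h0])
      exact haT ((smul_mem_vec hs).1 h1)
    refine ⟨u⁻¹ * s, ?_, fun t ht => ?_⟩
    · have : w + (u⁻¹ * s) • a = u⁻¹ • (s • a + u • w) := by
        rw [smul_add, smul_smul, smul_smul, inv_mul_cancel₀ hu, one_smul, add_comm]
      simp only [this]
      exact (smul_mem_vec (inv_ne_zero hu)).2 ⟨hx, hXT⟩
    · have := huniq (Projectivization.mk K (w + t • a) (hne t)) ⟨ht.2, (mk_mem_pts _).2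
        (Submodule.mem_span_pair.2 ⟨t, 1, by rw [one_smul, add_comm]⟩)⟩
      rw [Projectivization.mk_eq_mk_iff'] at this
      obtain ⟨c, hc⟩ := this
      have h2 := LinearIndependent.pair_iff.1 hli (c * s - t) (c * u - 1) (by
        rw [sub_smul, sub_smul, mul_smul, mul_smul, one_smul]
        rw [smul_add] at hc
        rw [sub_add_sub_comm, hc, add_comm w, sub_self])
      have h3 : c = u⁻¹ := by
        exact eq_inv_of_mul_eq_one_left (sub_eq_zero.1 h2.2)
      rw [← h3]; exact (sub_eq_zero.1 h2.1).symm

variable [Finite K]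

lemma ncard_vec [FiniteDimensional K V] (T : Set (ℙ K V)) :
    (vec T).ncard = (Nat.card K - 1) * T.ncard := by
  have : Finite V := Module.finite_of_finite K
  have e : (T × Kˣ) ≃ vec T := by
    refine Equiv.ofBijective (fun x => ⟨(x.2 : K) • (x.1 : ℙ K V).rep, ?_⟩) ⟨?_, ?_⟩
    · refine (smul_mem_vec x.2.ne_zero).2 ⟨Projectivization.rep_nonzero _, ?_⟩
      rw [Projectivization.mk_rep]; exact x.1.2
    · rintro ⟨⟨x, hx⟩, c⟩ ⟨⟨y, hy⟩, d⟩ h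
      simp only [Subtype.mk.injEq] at h
      have hxy : x = y := by
        rw [← Projectivization.mk_rep x, ← Projectivization.mk_rep y,
          Projectivization.mk_eq_mk_iff']
        refine ⟨(c : K)⁻¹ * d, ?_⟩
        rw [mul_smul, ← h, smul_smul, inv_mul_cancel₀ c.ne_zero, one_smul]
      subst hxy
      have hcd : (c : K) = d := smul_left_injective K (Projectivization.rep_nonzero x) h
      have hcd' : c = d := Units.ext hcd
      rw [hcd']
    · rintro ⟨v, hv, hT⟩
      obtain ⟨c, hc⟩ := Projectivization.exists_smul_eq_mk_rep K v hv
      refine ⟨(⟨_, hT⟩, c⁻¹), Subtype.ext ?_⟩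
      simp only [← hc, Units.smul_def, smul_smul]
      simp
  rw [← Nat.card_coe_set_eq, ← Nat.card_congr e, Nat.card_prod, Nat.card_coe_set_eq,
    Nat.card_units, mul_comm]

omit [Finite K] in
/-- If every line in the direction `c` that meets `D` is contained in `D` and meets `Y` in
a unique vector, then `D` has `|K|` times as many elements as `Y`. -/
lemma ncard_eq_mul_of_existsUnique {D Y : Set V} {c : V} (hYD : Y ⊆ D)
    (hD : ∀ w ∈ D, ∀ t : K, w + t • c ∈ D) (h : ∀ w ∈ D, ∃! t : K, w + t • c ∈ Y) :
    D.ncard = Nat.card K * Y.ncard := by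
  have e : (Y × K) ≃ D := by
    refine Equiv.ofBijective (fun x => ⟨(x.1 : V) + x.2 • c, hD _ (hYD x.1.2) _⟩) ⟨?_, ?_⟩
    · rintro ⟨⟨y, hy⟩, t⟩ ⟨⟨y', hy'⟩, t'⟩ hyy
      simp only [Subtype.mk.injEq] at hyy
      have h1 : t - t' = 0 := (h y (hYD hy)).unique (y₁ := t - t') (y₂ := 0)
        (by
          have : y + (t - t') • c = y' := by
            rw [sub_smul, ← add_sub_assoc, hyy, add_sub_cancel_right]
          rwa [this]) (by simpa using hy)
      obtain rfl := sub_eq_zero.1 h1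
      obtain rfl := add_right_cancel hyy
      rfl
    · rintro ⟨w, hw⟩
      obtain ⟨t, ht, -⟩ := h w hw
      exact ⟨(⟨_, ht⟩, -t), Subtype.ext (by simp)⟩
  rw [← Nat.card_coe_set_eq, ← Nat.card_congr e, Nat.card_prod, Nat.card_coe_set_eq, mul_comm]

omit [Finite K] in
lemma ncard_submodule [FiniteDimensional K V] (W : Submodule K V) :
    (W : Set V).ncard = Nat.card K ^ Module.finrank K W := by
  rw [← Nat.card_coe_set_eq]
  exact Module.natCard_eq_pow_finrank (K := K) (V := W)

lemma ncard_diff_submodule [FiniteDimensional K V] {W U : Submodule K V} (h : U ≤ W) :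
    ((W : Set V) \ U).ncard + Nat.card K ^ Module.finrank K U
      = Nat.card K ^ Module.finrank K W := by
  have : Finite V := Module.finite_of_finite K
  rw [← ncard_submodule, ← ncard_submodule]
  exact Set.ncard_sdiff_add_ncard_of_subset h

/-- The number of vectors that represent points of a set of points of `W` such that every line of
`W` through some point outside the set is a tangent. -/
lemma ncard_of_tangents [FiniteDimensional K V] {Y : Set V} {W : Submodule K V} {a : V}
    (ha : a ≠ 0) (haW : a ∈ W) (hY : Y ⊆ (W : Set V) \ (K ∙ a : Submodule K V))
    (h : ∀ w ∈ W, w ∉ K ∙ a → ∃! t : K, w + t • a ∈ Y) :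
    Nat.card K * Y.ncard + Nat.card K = Nat.card K ^ Module.finrank K W := by
  have h1 : ((W : Set V) \ (K ∙ a : Submodule K V)).ncard = Nat.card K * Y.ncard := by
    refine ncard_eq_mul_of_existsUnique hY ?_ fun w hw => h w hw.1 hw.2
    rintro w ⟨hw, hwa⟩ t
    refine ⟨W.add_mem hw (W.smul_mem _ haW), fun h2 => hwa ?_⟩
    exact (Submodule.add_mem_iff_left _
      (Submodule.smul_mem _ _ (Submodule.mem_span_singleton_self _))).1 h2
  have h2 := ncard_diff_submodule (K := K) ((Submodule.span_singleton_le_iff_mem a W).2 haW)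
  rw [finrank_span_singleton ha, pow_one] at h2
  rw [← h1, h2]

end Vectors

/-! ### Hyperplanes as kernels of functionals. -/

section Hyperplanes

variable {K V : Type*} [Field K] [AddCommGroup V] [Module K V] [FiniteDimensional K V]

lemma finrank_inf_ker_add_one {W : Submodule K V} {f : Module.Dual K V} {x : V} (hx : x ∈ W)
    (hfx : f x ≠ 0) :
    Module.finrank K (W ⊓ LinearMap.ker f : Submodule K V) + 1 = Module.finrank K W := by
  have h1 : f.domRestrict W ≠ 0 := fun h0 => hfx (by
    simpa using LinearMap.congr_fun h0 ⟨x, hx⟩)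
  have h2 := Module.Dual.finrank_ker_add_one_of_ne_zero h1
  rw [← h2]
  congr 1
  have e : LinearMap.ker (f.domRestrict W) ≃ₗ[K] (W ⊓ LinearMap.ker f : Submodule K V) := by
    refine (LinearEquiv.ofEq _ _ ?_).trans
      (Submodule.comapSubtypeEquivOfLe (inf_le_left : W ⊓ LinearMap.ker f ≤ W))
    ext ⟨y, hy⟩
    simp
  exact e.finrank_eq.symm

lemma isHyperplaneOf_inf_ker {W : Submodule K V} {f : Module.Dual K V} {x : V} (hx : x ∈ W)
    (hfx : f x ≠ 0) : IsHyperplaneOf (W ⊓ LinearMap.ker f) W :=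
  ⟨inf_le_left, finrank_inf_ker_add_one hx hfx⟩

lemma isHyperplaneOf_ker {f : Module.Dual K V} {x : V} (hfx : f x ≠ 0) :
    IsHyperplaneOf (LinearMap.ker f) ⊤ := by
  have := isHyperplaneOf_inf_ker (W := ⊤) (f := f) (x := x) trivial hfx
  rwa [top_inf_eq] at this

omit [FiniteDimensional K V] in
lemma exists_dual_ne_zero {W : Submodule K V} {x : V} (hx : x ∉ W) :
    ∃ f : Module.Dual K V, W ≤ LinearMap.ker f ∧ f x ≠ 0 := by
  obtain ⟨f, h1, h2⟩ := Submodule.exists_le_ker_of_notMem hx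
  exact ⟨f, h2, h1⟩

lemma IsHyperplaneOf.exists_eq_inf_ker {μ W : Submodule K V} (h : IsHyperplaneOf μ W) :
    ∃ f : Module.Dual K V, μ = W ⊓ LinearMap.ker f := by
  have hne : ∃ x ∈ W, x ∉ μ := by
    by_contra! h0
    have h1 := h.2
    rw [le_antisymm h.1 h0] at h1
    omega
  obtain ⟨x, hxW, hx⟩ := hne
  obtain ⟨f, hf, hfx⟩ := exists_dual_ne_zero hx
  refine ⟨f, Submodule.eq_of_le_of_finrank_eq (le_inf h.1 hf) ?_⟩
  have := finrank_inf_ker_add_one hxW hfx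
  have := h.2
  omega

end Hyperplanes

/-! ### Cardinalities with the denominator `q - 1` cleared. -/

section Cards

/-- The factor `q - 1` turns points into vectors; working in `ℤ` avoids truncated subtraction and
division. -/
lemma parabolicCard_mul {q : ℕ} (hq : 1 < q) (m : ℕ) :
    ((q : ℤ) - 1) * parabolicCard q m = (q : ℤ) ^ (2 * m) - 1 := by
  have h : q - 1 ∣ q ^ (2 * m) - 1 := by simpa using Nat.sub_dvd_pow_sub_pow q 1 (2 * m)
  have h1 : (q - 1) * parabolicCard q m = q ^ (2 * m) - 1 := Nat.mul_div_cancel' h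
  have h2 : 1 ≤ q ^ (2 * m) := Nat.one_le_pow _ _ (by omega)
  zify [h2, hq.le] at h1
  exact h1

/-- The index `m + 1` keeps the exponent `m - 1` of the definition from truncating. -/
lemma ellipticCard_mul {q : ℕ} (hq : 1 < q) (m : ℕ) :
    ((q : ℤ) - 1) * ellipticCard q (m + 1) = (q * (q : ℤ) ^ m + 1) * ((q : ℤ) ^ m - 1) := by
  have h : q - 1 ∣ q ^ m - 1 := by simpa using Nat.sub_dvd_pow_sub_pow q 1 m
  have h1 : (q - 1) * ellipticCard q (m + 1) = (q ^ (m + 1) + 1) * (q ^ m - 1) :=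
    Nat.mul_div_cancel' (h.mul_left _)
  have h2 : 1 ≤ q ^ m := Nat.one_le_pow _ _ (by omega)
  zify [h2, hq.le] at h1
  rw [h1, pow_succ']

lemma hyperbolicCard_mul {q : ℕ} (hq : 1 < q) (m : ℕ) :
    ((q : ℤ) - 1) * hyperbolicCard q (m + 1) = (q * (q : ℤ) ^ m - 1) * ((q : ℤ) ^ m + 1) := by
  have h : q - 1 ∣ q ^ (m + 1) - 1 := by simpa using Nat.sub_dvd_pow_sub_pow q 1 (m + 1)
  have h1 : (q - 1) * hyperbolicCard q (m + 1) = (q ^ (m + 1) - 1) * (q ^ m + 1) :=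
    Nat.mul_div_cancel' (h.mul_right _)
  have h2 : 1 ≤ q ^ (m + 1) := Nat.one_le_pow _ _ (by omega)
  zify [h2, hq.le] at h1
  rw [h1, pow_succ']

variable {K V : Type*} [Field K] [AddCommGroup V] [Module K V] [Finite K]

lemma cast_ncard_vec [FiniteDimensional K V] (T : Set (ℙ K V)) :
    ((vec T).ncard : ℤ) = ((Nat.card K : ℤ) - 1) * T.ncard := by
  rw [ncard_vec, Nat.cast_mul, Nat.cast_sub (Finite.one_lt_card (α := K)).le, Nat.cast_one]

lemma ncard_eq_of_vec [FiniteDimensional K V] {T : Set (ℙ K V)} {m : ℕ}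
    (h : ((vec T).ncard : ℤ) = ((Nat.card K : ℤ) - 1) * m) : T.ncard = m := by
  rw [cast_ncard_vec] at h
  have h1 : ((Nat.card K : ℤ) - 1) ≠ 0 := by
    have := Finite.one_lt_card (α := K)
    omega
  exact_mod_cast mul_left_cancel₀ h1 h

end Cards

/-! ### Inversion of the Radon transform on hyperplanes missing a point. -/

section Radon

variable {K V : Type*} [Field K] [AddCommGroup V] [Module K V]

/-- Adding `g` to a functional keeps its values at `c` and `z` and shifts its value at `x`, which
gives bijections between sets of hyperplanes. It exists because, by exchange, `x` is outside the
span of `z` and `c`. -/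
lemma exists_dual_translate {c x : V} (hx : x ∉ K ∙ c) {z : V}
    (hz : z = 0 ∨ z ∉ Submodule.span K {x, c}) (s : K) :
    ∃ g : Module.Dual K V, g c = 0 ∧ g x = s ∧ g z = 0 := by
  have hxz : x ∉ Submodule.span K {z, c} := by
    intro h
    rcases hz with rfl | hz
    · rw [Submodule.span_insert_zero] at h
      exact hx h
    · exact hz (mem_span_insert_exchange h hx)
  obtain ⟨h, hker, hne⟩ := exists_dual_ne_zero hxz
  refine ⟨(s / h x) • h, ?_, ?_, ?_⟩
  · have : h c = 0 := hker (Submodule.subset_span (by simp))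
    simp [this]
  · simp [hne]
  · have : h z = 0 := hker (Submodule.subset_span (by simp))
    simp [this]

open Classical in
/-- If all hyperplanes that do not contain `c` meet `Y` in equally many vectors, then `Y` meets
any two 1-spaces of a plane through `c`, other than the span of `c`, in equally many vectors. -/
lemma ncard_inter_span_eq [Finite K] [FiniteDimensional K V] {Y : Set V} {c : V}
    (hc : c ≠ 0) {m : ℕ}
    (hY : ∀ f : Module.Dual K V, f c ≠ 0 → (Y ∩ LinearMap.ker f).ncard = m)
    {x : V} (hx : x ∉ K ∙ c) (s : K) :
    (Y ∩ (K ∙ x : Submodule K V)).ncard = (Y ∩ (K ∙ (x + s • c) : Submodule K V)).ncard := by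
  have : Finite V := Module.finite_of_finite K
  have : Finite (Module.Dual K V) := Module.finite_of_finite K
  have := Fintype.ofFinite V
  have := Fintype.ofFinite (Module.Dual K V)
  have hc0 : c ∈ K ∙ c := Submodule.mem_span_singleton_self c
  set x' := x + s • c with hx'def
  have hx' : x' ∉ K ∙ c := fun h =>
    hx ((Submodule.add_mem_iff_left _ (Submodule.smul_mem _ _ hc0)).1 h)
  have hspan : Submodule.span K {x', c} = Submodule.span K {x, c} := by
    apply le_antisymm <;> rw [Submodule.span_le] <;> rintro y (rfl | rfl)
    · exact Submodule.mem_span_pair.2 ⟨1, s, by simp [hx'def]⟩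
    · exact Submodule.subset_span (by simp)
    · exact Submodule.mem_span_pair.2 ⟨1, -s, by simp [hx'def]⟩
    · exact Submodule.subset_span (by simp)
  -- Hyperplanes missing `c` are normalised by `f c = 1`. Pairs of `z ∈ Y` and `f ∈ F y` with `f z =
  -- 0` are counted twice, for `y = x` and `y = x'`.
  let F : V → Finset (Module.Dual K V) := fun y => Finset.univ.filter fun f => f c = 1 ∧ f y = 0
  let G : V → V → ℕ := fun y z => ((F y).filter fun f => f z = 0).card
  have htrans (z : V) (hz : z = 0 ∨ z ∉ Submodule.span K {x, c}) : G x z = G x' z := by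
    obtain ⟨g, hgc, hgx, hgz⟩ := exists_dual_translate hx hz (-s)
    refine Finset.card_equiv (Equiv.addRight g) fun f => ?_
    simp only [F, Finset.mem_filter, Finset.mem_univ, true_and, Equiv.coe_addRight,
      LinearMap.add_apply, hgc, hgz, add_zero, hx'def, map_add, map_smul, hgx, smul_eq_mul]
    constructor
    · rintro ⟨⟨h1, h2⟩, h3⟩
      exact ⟨⟨h1, by rw [h1, h2]; ring⟩, h3⟩
    · rintro ⟨⟨h1, h2⟩, h3⟩
      rw [h1] at h2
      exact ⟨⟨h1, by linear_combination h2⟩, h3⟩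
  have hG0 (y : V) : G y 0 = (F y).card := by simp [G]
  have hF : (F x).card = (F x').card := by rw [← hG0, ← hG0, htrans 0 (Or.inl rfl)]
  have hFpos : 0 < (F x).card := by
    obtain ⟨f, hf, hfc⟩ := exists_dual_ne_zero (K := K) (W := K ∙ x) (x := c) fun h => by
      obtain ⟨t, rfl⟩ := Submodule.mem_span_singleton.1 h
      have ht : t ≠ 0 := by
        rintro rfl
        exact hc (zero_smul K x)
      exact hx (Submodule.mem_span_singleton.2 ⟨t⁻¹, by simp [smul_smul, ht]⟩)
    refine Finset.card_pos.2 ⟨(f c)⁻¹ • f, ?_⟩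
    have hfx : f x = 0 := hf (Submodule.mem_span_singleton_self x)
    simp [F, hfc, hfx]
  have hval (y : V) (hy : y ∉ K ∙ c) (hys : Submodule.span K {y, c} = Submodule.span K {x, c})
      (z : V) (hz : z ∈ Submodule.span K {x, c}) :
      G y z = if z ∈ K ∙ y then (F y).card else 0 := by
    split_ifs with hzy
    · obtain ⟨t, rfl⟩ := Submodule.mem_span_singleton.1 hzy
      refine congrArg Finset.card (Finset.filter_true_of_mem fun f hf => ?_)
      have : f y = 0 := (Finset.mem_filter.1 hf).2.2
      simp [this]
    · refine Finset.card_eq_zero.2 (Finset.filter_false_of_mem fun f hf hfz => hzy ?_)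
      rw [← hys, Submodule.mem_span_pair] at hz
      obtain ⟨t, u, rfl⟩ := hz
      obtain ⟨-, h1, h2⟩ := Finset.mem_filter.1 hf
      simp only [map_add, map_smul, h1, h2, smul_eq_mul, mul_zero, mul_one, zero_add] at hfz
      exact Submodule.mem_span_singleton.2 ⟨t, by simp [hfz]⟩
  have hsum (y : V) : ∑ z ∈ Y.toFinset, G y z = (F y).card * m := by
    have h1 := Finset.sum_card_bipartiteAbove_eq_sum_card_bipartiteBelow (s := Y.toFinset)
      (t := F y) (fun z f => f z = 0)
    refine h1.trans ?_
    rw [Finset.sum_const_nat (m := m)]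
    intro f hf
    have hfc : f c = 1 := (Finset.mem_filter.1 hf).2.1
    rw [← hY f (by simp [hfc]), ← Set.ncard_coe_finset]
    congr 1
    ext z
    simp [Finset.bipartiteBelow]
  have hcount (y : V) : ∑ z ∈ Y.toFinset, (if z ∈ K ∙ y then (F x).card else 0)
      = (Y ∩ (K ∙ y : Submodule K V)).ncard * (F x).card := by
    rw [← Finset.sum_filter, Finset.sum_const, smul_eq_mul, ← Set.ncard_coe_finset]
    congr 2
    ext z
    simp
  have hle (y : V) (hys : Submodule.span K {y, c} = Submodule.span K {x, c}) :
      (K ∙ y) ≤ Submodule.span K {x, c} := by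
    rw [← hys]; exact Submodule.span_mono (by simp)
  -- Off the plane of `x` and `c` the counts `G x` and `G x'` agree; on it each is a multiple of the
  -- indicator of a 1-space. The indicators are added crosswise to avoid subtraction in `ℕ`.
  have hpoint (z : V) : G x z + (if z ∈ K ∙ x' then (F x).card else 0)
      = G x' z + (if z ∈ K ∙ x then (F x).card else 0) := by
    by_cases hz : z ∈ Submodule.span K {x, c}
    · rw [hval x hx rfl z hz, hval x' hx' hspan z hz, hF, add_comm]
    · rw [htrans z (Or.inr hz), if_neg fun h => hz (hle x rfl h),
        if_neg fun h => hz (hle x' hspan h)]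
  have := Finset.sum_congr (rfl : Y.toFinset = Y.toFinset) fun z _ => hpoint z
  rw [Finset.sum_add_distrib, Finset.sum_add_distrib, hsum, hsum, hcount, hcount, hF] at this
  rw [hF] at hFpos
  exact (Nat.eq_of_mul_eq_mul_right hFpos (Nat.add_left_cancel this)).symm

/-- If all hyperplanes that do not contain the vector `c` meet `T` in equally many points, then
`T` is closed under adding multiples of `c` to vectors outside the span of `c`. -/
lemma add_smul_mem_vec [Finite K] [FiniteDimensional K V] {T : Set (ℙ K V)} {c : V}
    (hc : c ≠ 0) {m : ℕ}
    (hT : ∀ f : Module.Dual K V, f c ≠ 0 → (vec T ∩ LinearMap.ker f).ncard = m)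
    {x : V} (hx : x ∉ K ∙ c) (hxT : x ∈ vec T) (s : K) : x + s • c ∈ vec T := by
  have : Finite V := Module.finite_of_finite K
  have h := ncard_inter_span_eq hc hT hx s
  have h1 : 0 < (vec T ∩ (K ∙ x : Submodule K V)).ncard :=
    (Set.ncard_pos (Set.toFinite _)).2 ⟨x, hxT, Submodule.mem_span_singleton_self x⟩
  rw [h] at h1
  obtain ⟨y, hy, hyx⟩ := (Set.ncard_pos (Set.toFinite _)).1 h1
  obtain ⟨t, rfl⟩ := Submodule.mem_span_singleton.1 hyx
  have ht : t ≠ 0 := fun h0 => ne_zero_of_mem_vec hy (by simp [h0])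
  exact (smul_mem_vec ht).1 hy

end Radon

/-! ### Cones from invariance under translation by the vertex. -/

section Cones

variable {K V : Type*} [Field K] [AddCommGroup V] [Module K V]

/-- A vector `x` of `T` outside the span of `c` slides along `c` to `x - (g x / g c) • c`, which
lies in the base `ker g`. -/
lemma isConeWithBase_of_add_smul_mem {T : Set (ℙ K V)} {π μ : Submodule K V} {c : V}
    {hc : c ≠ 0} (hTπ : T ⊆ pts π) (hcπ : c ∈ π) (hcT : c ∈ vec T)
    (hT : ∀ x ∈ vec T, x ∉ K ∙ c → ∀ s : K, x + s • c ∈ vec T)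
    {g : Module.Dual K V} (hgc : g c ≠ 0) (hμ : IsHyperplaneOf μ π)
    (hμg : μ = π ⊓ LinearMap.ker g) :
    IsConeWithBase π T (Projectivization.mk K c hc) μ (T ∩ pts μ) where
  vertex_mem := (mk_mem_pts hc).2 hcπ
  hyperplane := hμ
  vertex_notMem := by
    rw [mk_mem_pts, hμg]
    exact fun h => hgc h.2
  base_subset := Set.inter_subset_right
  eq_cone := by
    have hcspan (x : V) (hx0 : x ≠ 0) (hx : x ∈ K ∙ c) : x ∈ vec T := by
      obtain ⟨t, rfl⟩ := Submodule.mem_span_singleton.1 hx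
      exact (smul_mem_vec fun h0 => hx0 (by simp [h0])).2 hcT
    apply vec_injective
    ext x
    by_cases hx0 : x = 0
    · exact ⟨fun h => absurd hx0 (ne_zero_of_mem_vec h), fun h => absurd hx0 (ne_zero_of_mem_vec h)⟩
    rw [mem_cone_iff hc hx0]
    constructor
    · intro hxT
      by_cases hxc : x ∈ K ∙ c
      · exact Or.inl hxc
      refine Or.inr ⟨x + (-(g x / g c)) • c, ?_, g x / g c, 1, ?_⟩
      · rw [vec_inter_pts, hμg]
        have hxπ : x ∈ π := (mk_mem_pts hx0).1 (hTπ hxT.2)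
        refine ⟨hT x hxT hxc _, π.add_mem hxπ (π.smul_mem _ hcπ), ?_⟩
        simp [hgc]
      · rw [one_smul, neg_smul]; abel
    · rintro (h | ⟨y, hy, t, s, rfl⟩)
      · exact hcspan x hx0 h
      · by_cases hs : s = 0
        · refine hcspan _ hx0 (Submodule.mem_span_singleton.2 ⟨t, by simp [hs]⟩)
        · rw [vec_inter_pts, hμg] at hy
          rw [add_comm]
          refine hT _ ((smul_mem_vec hs).2 hy.1) (fun h => ?_) t
          obtain ⟨u, hu⟩ := Submodule.mem_span_singleton.1 h
          have h1 : g (u • c) = 0 := by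
            rw [hu, map_smul, LinearMap.mem_ker.1 hy.2.2, smul_zero]
          rw [map_smul, smul_eq_mul, mul_eq_zero, or_iff_left hgc] at h1
          rw [h1, zero_smul] at hu
          exact ne_zero_of_mem_vec ((smul_mem_vec hs).2 hy.1) hu.symm

variable [Finite K] [FiniteDimensional K V]

omit [Finite K] [FiniteDimensional K V] in
-- Each line in direction `c` meets `ker g` in exactly one vector.
lemma ncard_inter_diff_span {T : Set (ℙ K V)} {c : V}
    (hT : ∀ x ∈ vec T, x ∉ K ∙ c → ∀ s : K, x + s • c ∈ vec T)
    {U : Submodule K V} (hcU : c ∈ U) {g : Module.Dual K V} (hgc : g c ≠ 0) :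
    ((vec T ∩ U) \ (K ∙ c : Submodule K V)).ncard
      = Nat.card K * (vec T ∩ U ∩ LinearMap.ker g).ncard := by
  refine ncard_eq_mul_of_existsUnique (c := c) ?_ ?_ ?_
  · rintro x ⟨hx, hxg⟩
    refine ⟨hx, fun h => ?_⟩
    obtain ⟨u, rfl⟩ := Submodule.mem_span_singleton.1 h
    have h1 : g (u • c) = 0 := hxg
    rw [map_smul, smul_eq_mul, mul_eq_zero, or_iff_left hgc] at h1
    exact ne_zero_of_mem_vec hx.1 (by simp [h1])
  · rintro w ⟨⟨hw, hwU⟩, hwc⟩ t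
    refine ⟨⟨hT w hw hwc t, U.add_mem hwU (U.smul_mem _ hcU)⟩, fun h => hwc ?_⟩
    exact (Submodule.add_mem_iff_left _
      (Submodule.smul_mem _ _ (Submodule.mem_span_singleton_self _))).1 h
  · rintro w ⟨⟨hw, hwU⟩, hwc⟩
    refine ⟨-(g w / g c), ⟨⟨hT w hw hwc _, U.add_mem hwU (U.smul_mem _ hcU)⟩, by simp [hgc]⟩, ?_⟩
    rintro t ⟨-, ht⟩
    have h1 : g w + t * g c = 0 := by simpa using ht
    field_simp
    linear_combination h1

/-- The vertex contributes its `q - 1` nonzero multiples to the count outside its span. -/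
lemma ncard_inter_of_vertex_mem {T : Set (ℙ K V)} {c : V} (hcT : c ∈ vec T)
    (hT : ∀ x ∈ vec T, x ∉ K ∙ c → ∀ s : K, x + s • c ∈ vec T)
    {U : Submodule K V} (hcU : c ∈ U) {g : Module.Dual K V} (hgc : g c ≠ 0) :
    (vec T ∩ U).ncard + 1
      = Nat.card K * (vec T ∩ U ∩ LinearMap.ker g).ncard + Nat.card K := by
  have : Finite V := Module.finite_of_finite K
  have h1 : (vec T ∩ U) ∩ (K ∙ c : Submodule K V)
      = ((K ∙ c : Submodule K V) : Set V) \ (⊥ : Submodule K V) := by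
    ext x
    constructor
    · rintro ⟨⟨hx, -⟩, hxc⟩
      exact ⟨hxc, fun h => ne_zero_of_mem_vec hx h⟩
    · rintro ⟨hxc, hx0⟩
      obtain ⟨t, rfl⟩ := Submodule.mem_span_singleton.1 hxc
      exact ⟨⟨(smul_mem_vec fun h0 => hx0 (by simp [h0])).2 hcT, U.smul_mem _ hcU⟩, hxc⟩
  have h2 := Set.ncard_inter_add_ncard_sdiff_eq_ncard (vec T ∩ U) (K ∙ c : Submodule K V)
    (Set.toFinite _)
  have h3 := ncard_diff_submodule (K := K) (bot_le : ⊥ ≤ (K ∙ c : Submodule K V))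
  rw [finrank_span_singleton (ne_zero_of_mem_vec hcT), finrank_bot, pow_one, pow_zero] at h3
  rw [ncard_inter_diff_span hT hcU hgc, h1] at h2
  omega

/-- A set `T` of points in a space `π` of even dimension `2n` whose lines through the point of `a`
are tangents and whose intersections with hyperplanes have suitable sizes is a cone with vertex the
point of `c`, and the bases of this cone are parabolic quasi-quadrics. -/
theorem isCone_and_bases {T : Set (ℙ K V)} {π : Submodule K V} {k : ℕ}
    (hπ : Module.finrank K π = 2 * (k + 2)) (hTπ : T ⊆ pts π) {a c : V} {ha : a ≠ 0} {hc : c ≠ 0}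
    (hcπ : c ∈ π)
    (hcard : ((vec T).ncard : ℤ) = Nat.card K * ((Nat.card K : ℤ) ^ (k + 1)) ^ 2 - 1)
    (hoff : ∀ f : Module.Dual K V, f c ≠ 0 →
      ((vec T ∩ LinearMap.ker f).ncard : ℤ) = ((Nat.card K : ℤ) ^ (k + 1)) ^ 2 - 1)
    (hon : ∀ f : Module.Dual K V, f a ≠ 0 → f c = 0 →
      ((vec T ∩ LinearMap.ker f).ncard : ℤ) = ((Nat.card K : ℤ) ^ (k + 1)) ^ 2 - 1
          - (Nat.card K - 1) * (Nat.card K : ℤ) ^ (k + 1) ∨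
      ((vec T ∩ LinearMap.ker f).ncard : ℤ) = ((Nat.card K : ℤ) ^ (k + 1)) ^ 2 - 1
          + (Nat.card K - 1) * (Nat.card K : ℤ) ^ (k + 1))
    (htan : OnlyTangentsThrough π T (Projectivization.mk K a ha)) :
    IsCone π T (Projectivization.mk K c hc) ∧
      ∀ μ : Submodule K V, IsHyperplaneOf μ π → Projectivization.mk K a ha ∈ pts μ →
        Projectivization.mk K c hc ∉ pts μ →
        IsConeWithBase π T (Projectivization.mk K c hc) μ (T ∩ pts μ) ∧
          IsParabolicQuasiQuadricWithNucleus (k + 1) μ (T ∩ pts μ)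
            (Projectivization.mk K a ha) := by
  have : Finite V := Module.finite_of_finite K
  have hq : 1 < Nat.card K := Finite.one_lt_card
  set q := Nat.card K with hqdef
  have hT (x : V) (hxT : x ∈ vec T) (hxc : x ∉ K ∙ c) (s : K) : x + s • c ∈ vec T := by
    refine add_smul_mem_vec hc (m := (((q : ℤ) ^ (k + 1)) ^ 2 - 1).toNat) (fun f hf => ?_) hxc hxT s
    rw [← hoff f hf, Int.toNat_natCast]
  -- Without the vertex, `T` would have `q` times as many vectors as its section by `ker g`: with `r
  -- = q ^ (k + 1)`, `q r² - 1 = q (r² - 1)`, so `q = 1`.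
  have hcT : c ∈ vec T := by
    obtain ⟨g, -, hgc⟩ := exists_dual_ne_zero (K := K) (W := ⊥) (x := c) (by simpa using hc)
    by_contra hcT
    have h1 := ncard_inter_diff_span hT (U := ⊤) trivial hgc
    have h2 : vec T \ (K ∙ c : Submodule K V) = vec T := by
      refine sdiff_eq_left.2 (Set.disjoint_left.2 fun x hx hxc => hcT ?_)
      obtain ⟨t, rfl⟩ := Submodule.mem_span_singleton.1 hxc
      exact (smul_mem_vec fun h0 => ne_zero_of_mem_vec hx (by simp [h0])).1 hx
    rw [Submodule.top_coe, Set.inter_univ, h2] at h1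
    zify at h1
    rw [hcard, hoff g hgc, mul_sub] at h1
    have : (q : ℤ) = 1 := by linarith
    omega
  have hcone (μ : Submodule K V) (hμ : IsHyperplaneOf μ π) (g : Module.Dual K V) (hgc : g c ≠ 0)
      (hμg : μ = π ⊓ LinearMap.ker g) :
      IsConeWithBase π T (Projectivization.mk K c hc) μ (T ∩ pts μ) :=
    isConeWithBase_of_add_smul_mem hTπ hcπ hcT hT hgc hμ hμg
  have hTker (f : Module.Dual K V) :
      vec (T ∩ pts (π ⊓ LinearMap.ker f)) = vec T ∩ LinearMap.ker f := by
    rw [vec_inter_pts]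
    ext x
    refine ⟨fun h => ⟨h.1, h.2.2⟩, fun h => ⟨h.1, ?_, h.2⟩⟩
    exact (mk_mem_pts _).1 (hTπ h.1.2)
  refine ⟨?_, fun μ hμ haμ hcμ => ?_⟩
  · obtain ⟨g, -, hgc⟩ := exists_dual_ne_zero (K := K) (W := ⊥) (x := c) (by simpa using hc)
    exact ⟨_, _, hcone _ (isHyperplaneOf_inf_ker hcπ hgc) g hgc rfl⟩
  · obtain ⟨g, hμg⟩ := hμ.exists_eq_inf_ker
    rw [mk_mem_pts] at haμ hcμ
    have hgc : g c ≠ 0 := fun h => hcμ (by rw [hμg]; exact ⟨hcπ, h⟩)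
    have hga : g a = 0 := by rw [hμg] at haμ; exact haμ.2
    refine ⟨hcone μ hμ g hgc hμg, ?_, Set.inter_subset_right, (mk_mem_pts _).2 haμ, ?_, ?_, ?_⟩
    · have := hμ.2
      omega
    · refine ncard_eq_of_vec ?_
      rw [hμg, hTker, hoff g hgc, parabolicCard_mul hq]
      ring
    · intro H hH haH
      obtain ⟨f, hHf⟩ := hH.exists_eq_inf_ker
      rw [mk_mem_pts] at haH
      have hfa : f a ≠ 0 := fun h => haH (by rw [hHf]; exact ⟨haμ, h⟩)
      -- `f'` agrees with `f` on `ker g` and vanishes at `c`. So `ker f'` cuts `T` in a cone over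
      -- the section of the base by `H`, whose size is controlled by `hon`.
      set f' := f - (f c / g c) • g with hf'
      have hf'c : f' c = 0 := by simp [hf', hgc]
      have hf'a : f' a ≠ 0 := by simpa [hf', hga] using hfa
      have h1 := ncard_inter_of_vertex_mem hcT hT (U := LinearMap.ker f') hf'c hgc
      have h2 : vec (T ∩ pts μ ∩ pts H) = vec T ∩ LinearMap.ker f' ∩ LinearMap.ker g := by
        rw [vec_inter_pts, hHf, hμg, hTker]
        ext x
        simp only [Set.mem_inter_iff, SetLike.mem_coe, Submodule.mem_inf, LinearMap.mem_ker, hf',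
          LinearMap.sub_apply, LinearMap.smul_apply, smul_eq_mul]
        constructor
        · rintro ⟨⟨h1, h2⟩, -, h3⟩
          exact ⟨⟨h1, by rw [h2, h3]; ring⟩, h2⟩
        · rintro ⟨⟨h1, h2⟩, h3⟩
          refine ⟨⟨h1, h3⟩, ⟨(mk_mem_pts _).1 (hTπ h1.2), h3⟩, ?_⟩
          rw [h3] at h2
          linear_combination h2
      rw [← h2] at h1
      zify at h1
      have hq0 : (q : ℤ) ≠ 0 := by omega
      rcases hon f' hf'a hf'c with h3 | h3
      · left
        refine ncard_eq_of_vec (mul_left_cancel₀ hq0 ?_)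
        rw [h3] at h1
        rw [ellipticCard_mul hq]
        rw [pow_succ'] at h1
        linear_combination -h1
      · right
        refine ncard_eq_of_vec (mul_left_cancel₀ hq0 ?_)
        rw [h3] at h1
        rw [hyperbolicCard_mul hq]
        rw [pow_succ'] at h1
        linear_combination -h1
    · intro L hL hL2 haL
      have h1 := htan L (hL.trans hμ.1) hL2 haL
      have h2 : T ∩ pts μ ∩ pts L = T ∩ pts L := by
        ext x
        exact ⟨fun h => ⟨h.1.1, h.2⟩, fun h => ⟨⟨h.1, le_trans h.2 hL⟩, h.2⟩⟩
      rwa [h2]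

end Cones

/-! ### Nuclei, radicals and tangent hyperplanes of quadrics in characteristic two. -/

section Quadrics

variable {K V : Type*} [Field K] [AddCommGroup V] [Module K V]

lemma map_add_smul (Q : QuadraticForm K V) (v a : V) (t : K) :
    Q (v + t • a) = Q v + t * t * Q a + t * QuadraticMap.polar Q v a := by
  rw [QuadraticMap.map_add (⇑Q), QuadraticMap.map_smul, QuadraticMap.polar_smul_right, smul_eq_mul,
    smul_eq_mul]

variable [CharP K 2]

lemma polar_self_eq_zero (Q : QuadraticForm K V) (v : V) : QuadraticMap.polar Q v v = 0 := by
  rw [QuadraticMap.polar_self, two_smul, CharTwo.add_self_eq_zero]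

/-- In characteristic two, the roots of the quadratic `Q (v + t • a)` in `t` differ by `B(v, a) / Q
a`. -/
lemma polar_eq_zero_of_existsUnique {Q : QuadraticForm K V} {v a : V} (ha : Q a ≠ 0)
    (h : ∃! t : K, Q (v + t • a) = 0) : QuadraticMap.polar Q v a = 0 := by
  obtain ⟨t, ht, huniq⟩ := h
  have h1 := huniq (t + QuadraticMap.polar Q v a / Q a) (by
    simp only [map_add_smul] at ht ⊢
    have h2 : (2 : K) = 0 := CharTwo.two_eq_zero
    field_simp
    linear_combination Q a * ht + (t * Q a * QuadraticMap.polar Q v a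
      + QuadraticMap.polar Q v a ^ 2) * h2)
  have h2 : QuadraticMap.polar Q v a / Q a = 0 := by simpa using h1
  exact (div_eq_zero_iff.1 h2).resolve_right ha

/-- A nucleus of a quadric lies in the radical of the polar form. -/
lemma IsNucleus.polar_eq_zero {Q : QuadraticForm K V} {a : V} {ha : a ≠ 0}
    (h : IsNucleus (quadric Q) (Projectivization.mk K a ha)) :
    Q a ≠ 0 ∧ ∀ v, QuadraticMap.polar Q v a = 0 := by
  have haS : a ∉ vec (quadric Q) := fun h1 => h.1 h1.2
  have hQa : Q a ≠ 0 := fun h1 => haS (by rw [vec_quadric]; exact ⟨ha, h1⟩)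
  refine ⟨hQa, fun v => ?_⟩
  by_cases hv : v ∈ K ∙ a
  · obtain ⟨t, rfl⟩ := Submodule.mem_span_singleton.1 hv
    rw [QuadraticMap.polar_smul_left, polar_self_eq_zero, smul_zero]
  · refine polar_eq_zero_of_existsUnique hQa ?_
    obtain ⟨t, ht, huniq⟩ := h.2.existsUnique trivial haS (Submodule.mem_top (x := v)) hv
    rw [vec_quadric] at ht
    refine ⟨t, ht.2, fun s hs => huniq s ?_⟩
    rw [vec_quadric]
    refine ⟨fun h0 => hv (Submodule.mem_span_singleton.2 ⟨-s, ?_⟩), hs⟩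
    rw [neg_smul]; exact (eq_neg_of_add_eq_zero_left h0).symm

omit [CharP K 2] in
lemma mem_radical {Q : QuadraticForm K V} {v : V} :
    v ∈ Q.radical ↔ Q v = 0 ∧ ∀ w, QuadraticMap.polar Q v w = 0 := by
  change Q v = 0 ∧ QuadraticMap.polarBilin Q v = 0 ↔ _
  rw [LinearMap.ext_iff]
  rfl

/-- Every element of `K` is a square, so some `v + s • a` is singular as well as orthogonal to
everything, hence zero. -/
lemma mem_span_of_polar_eq_zero [Finite K] {Q : QuadraticForm K V} (hQ : Q.radical = ⊥) {a : V}
    (ha : Q a ≠ 0) (hpol : ∀ v, QuadraticMap.polar Q v a = 0) {v : V}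
    (hv : ∀ w, QuadraticMap.polar Q v w = 0) : v ∈ K ∙ a := by
  obtain ⟨s, hs⟩ := FiniteField.isSquare_of_char_two (ringChar.eq K 2) (Q v / Q a)
  have h1 : v + s • a ∈ Q.radical := by
    refine mem_radical.2 ⟨?_, fun w => ?_⟩
    · rw [map_add_smul, ← hs, hpol, div_mul_cancel₀ _ ha, mul_zero, add_zero,
        CharTwo.add_self_eq_zero]
    · rw [QuadraticMap.polar_add_left, QuadraticMap.polar_smul_left, hv, QuadraticMap.polar_comm,
        hpol, smul_zero, add_zero]
  rw [hQ, Submodule.mem_bot] at h1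
  refine Submodule.mem_span_singleton.2 ⟨-s, ?_⟩
  rw [neg_smul]; exact (eq_neg_of_add_eq_zero_left h1).symm

variable [Finite K] [FiniteDimensional K V]

omit [CharP K 2] [Finite K] in
/-- A totally singular subspace has at most half the dimension of the space. -/
lemma two_mul_finrank_le {Q : QuadraticForm K V} (hQ : Q.radical = ⊥) {U : Submodule K V}
    (hU : ∀ v ∈ U, Q v = 0) : 2 * Module.finrank K U ≤ Module.finrank K V := by
  have hpol (v : V) (hv : v ∈ U) (w : V) (hw : w ∈ U) : QuadraticMap.polar Q v w = 0 := by
    rw [QuadraticMap.polar, hU _ (U.add_mem hv hw), hU _ hv, hU _ hw, sub_zero, sub_zero]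
  -- The polar form may be degenerate, but a singular vector in its kernel is in the radical, so the
  -- correction term for `U` vanishes.
  have h1 := LinearMap.BilinForm.finrank_add_finrank_orthogonal'
    (B := QuadraticMap.polarBilin Q) U
  have h2 : U ⊓ LinearMap.ker (QuadraticMap.polarBilin Q) = ⊥ := by
    rw [eq_bot_iff, ← hQ]
    rintro v ⟨hv, hv'⟩
    refine mem_radical.2 ⟨hU v hv, fun w => ?_⟩
    exact LinearMap.congr_fun (LinearMap.mem_ker.1 hv') w
  have h3 : U ≤ LinearMap.BilinForm.orthogonal (QuadraticMap.polarBilin Q) U :=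
    fun v hv w hw => hpol w hw v hv
  rw [h2, finrank_bot] at h1
  have := Submodule.finrank_mono h3
  omega

omit [CharP K 2] in
/-- A singular hyperplane of a quadric is the orthogonal space of its vertex. -/
lemma IsSingularHyperplaneWithVertex.eq_ker {Q : QuadraticForm K V} {k : ℕ}
    (hV : Module.finrank K V = 2 * (k + 2) + 1) (hQ : Q.radical = ⊥) {π : Submodule K V} {p : V}
    {hp : p ≠ 0}
    (h : IsSingularHyperplaneWithVertex (k + 2) (quadric Q) π (Projectivization.mk K p hp)) :
    Q p = 0 ∧ π = LinearMap.ker (QuadraticMap.polarBilin Q p) := by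
  have : Finite V := Module.finite_of_finite K
  have hq : 1 < Nat.card K := Finite.one_lt_card
  have hπfin : Module.finrank K π = 2 * (k + 2) := by
    have := h.hyperplane.2
    rw [finrank_top, hV] at this
    omega
  obtain ⟨μ, B, hB⟩ := h.isCone
  have hvec : vec (quadric Q ∩ pts π) = {v | v ≠ 0 ∧ Q v = 0} ∩ π := by
    rw [vec_inter_pts, vec_quadric]
  have hmem (x : V) : x ∈ vec (cone (Projectivization.mk K p hp) B) ↔
      (x ≠ 0 ∧ Q x = 0) ∧ x ∈ π := by
    rw [← hB.eq_cone, hvec]; rfl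
  have hQp : Q p = 0 :=
    ((hmem p).1 ((mem_cone_iff hp hp B).2 (Or.inl (Submodule.mem_span_singleton_self p)))).1.2
  -- The line joining `p` to a point of the cone consists of singular points.
  have hpol (x : V) (hx : x ≠ 0) (hQx : Q x = 0) (hxπ : x ∈ π) : QuadraticMap.polar Q p x = 0 := by
    by_cases hxp : x + p = 0
    · rw [eq_neg_of_add_eq_zero_left hxp, QuadraticMap.polar_neg_right, QuadraticMap.polar_self,
        hQp, smul_zero, neg_zero]
    have hxc := (hmem x).2 ⟨⟨hx, hQx⟩, hxπ⟩
    have h1 : Q (x + p) = 0 := by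
      refine ((hmem (x + p)).1 ?_).1.2
      rw [mem_cone_iff hp hxp]
      rcases (mem_cone_iff hp hx B).1 hxc with h | ⟨y, hy, t, s, rfl⟩
      · exact Or.inl (Submodule.add_mem _ h (Submodule.mem_span_singleton_self p))
      · exact Or.inr ⟨y, hy, t + 1, s, by rw [add_smul, one_smul]; abel⟩
    rw [QuadraticMap.polar_comm, QuadraticMap.polar, h1, hQx, hQp, sub_zero, sub_zero]
  refine ⟨hQp, ?_⟩
  obtain ⟨w, hw⟩ : ∃ w, QuadraticMap.polarBilin Q p w ≠ 0 := by
    by_contra! h0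
    have : p ∈ Q.radical := mem_radical.2 ⟨hQp, h0⟩
    rw [hQ] at this
    exact hp this
  have hφfin := (isHyperplaneOf_ker hw).2
  rw [finrank_top, hV] at hφfin
  refine Submodule.eq_of_le_of_finrank_eq (fun x hx => ?_) (by omega)
  -- Otherwise all singular points of `π` lie in `U`, of dimension `2k + 3`. Their number equals
  -- that of all points of `U`, so `U` is totally singular, too large for a space of dimension `2k +
  -- 5`.
  by_contra hxφ
  have hUfin := finrank_inf_ker_add_one hx hxφ
  set U := π ⊓ LinearMap.ker (QuadraticMap.polarBilin Q p) with hU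
  have hsub : vec (quadric Q ∩ pts π) ⊆ (U : Set V) \ (⊥ : Submodule K V) := by
    rw [hvec]
    rintro y ⟨⟨hy0, hQy⟩, hyπ⟩
    exact ⟨⟨hyπ, hpol y hy0 hQy hyπ⟩, hy0⟩
  have h1 := cast_ncard_vec (quadric Q ∩ pts π)
  rw [h.card_eq, singularCard, Nat.add_succ_sub_one] at h1
  push_cast at h1
  have h2 := parabolicCard_mul hq (k + 1)
  have h3 := ncard_diff_submodule (K := K) (bot_le : ⊥ ≤ U)
  rw [finrank_bot, pow_zero, show Module.finrank K U = 2 * (k + 1) + 1 by omega] at h3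
  zify at h3
  have heq := Set.eq_of_subset_of_ncard_le hsub (by
    zify
    rw [pow_succ] at h3
    refine le_of_eq ?_
    linear_combination h3 - h1 - (Nat.card K : ℤ) * h2)
  have hsing (v : V) (hv : v ∈ U) : Q v = 0 := by
    by_cases hv0 : v = 0
    · rw [hv0, QuadraticMap.map_zero]
    · have : v ∈ vec (quadric Q ∩ pts π) := by rw [heq]; exact ⟨hv, hv0⟩
      rw [hvec] at this
      exact this.1.2
  have := two_mul_finrank_le hQ hsing
  omega

end Quadrics

/-! ### Subgroups of index two and their sign characters. -/

section Levels

variable {K V : Type*} [Field K] [AddCommGroup V] [Module K V] [CharP K 2]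

/-- The additive polynomial function `t ↦ A t² + b t` in characteristic two. -/
def sqAddLin (A b : K) : K →+ K where
  toFun t := A * (t * t) + b * t
  map_zero' := by simp
  map_add' s t := by
    have h2 : (2 : K) = 0 := CharTwo.two_eq_zero
    linear_combination A * s * t * h2

lemma sqAddLin_apply (A b t : K) : sqAddLin A b t = A * (t * t) + b * t := rfl

/-- Since `A t² + b t = t (A t + b)`, the kernel is `{0, b / A}`. -/
lemma two_mul_card_range_sqAddLin [Finite K] {A b : K} (hA : A ≠ 0) (hb : b ≠ 0) :
    Nat.card (sqAddLin A b).range * 2 = Nat.card K := by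
  have h1 : Nat.card (sqAddLin A b).ker = 2 := by
    have : ((sqAddLin A b).ker : Set K) = {0, b / A} := by
      ext t
      simp only [SetLike.mem_coe, AddMonoidHom.mem_ker, sqAddLin_apply, Set.mem_insert_iff,
        Set.mem_singleton_iff]
      have : A * (t * t) + b * t = t * (A * t + b) := by ring
      rw [this, mul_eq_zero, CharTwo.add_eq_zero, eq_div_iff hA, mul_comm A t]
    have h2 := Set.ncard_pair (a := (0 : K)) (b := b / A) (div_ne_zero hb hA).symm
    rw [← this, ← Nat.card_coe_set_eq] at h2
    exact h2
  rw [← AddSubgroup.index_ker, mul_comm, ← h1, AddSubgroup.card_mul_index]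

lemma index_range_sqAddLin [Finite K] {A b : K} (hA : A ≠ 0) (hb : b ≠ 0) :
    (sqAddLin A b).range.index = 2 := by
  have h1 := two_mul_card_range_sqAddLin hA hb
  have h2 := AddSubgroup.card_mul_index (sqAddLin A b).range
  rw [← h1] at h2
  exact Nat.eq_of_mul_eq_mul_left Nat.card_pos h2

open Classical in
/-- The nontrivial character with values `±1` whose kernel is the given subgroup of index two. -/
noncomputable def signOf {K : Type*} [AddCommGroup K] (G : AddSubgroup K) (t : K) : ℤ :=
  if t ∈ G then 1 else -1

lemma signOf_add {K : Type*} [AddCommGroup K] {G : AddSubgroup K} (hG : G.index = 2) (s t : K) :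
    signOf G (s + t) = signOf G s * signOf G t := by
  unfold signOf
  have := AddSubgroup.add_mem_iff_of_index_two hG (a := s) (b := t)
  by_cases hs : s ∈ G <;> by_cases ht : t ∈ G <;> simp [this, hs, ht]

lemma exists_signOf_eq_neg_one {K : Type*} [AddCommGroup K] {G : AddSubgroup K}
    (hG : G.index = 2) : ∃ t, signOf G t = -1 := by
  by_contra! h
  have : G = ⊤ := by
    rw [eq_top_iff]
    intro t _
    by_contra ht
    exact h t (by simp [signOf, ht])
  rw [this, AddSubgroup.index_top] at hG
  omega

/-- A sum that is negated by a permutation of its index set is zero. -/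
lemma sum_eq_zero_of_shift {α : Type*} {s : Finset α} {h : α → ℤ} (e : α ≃ α)
    (he : ∀ v, v ∈ s ↔ e v ∈ s) (hh : ∀ v ∈ s, h (e v) = -h v) : ∑ v ∈ s, h v = 0 := by
  have h1 : ∑ v ∈ s, -h v = ∑ v ∈ s, h v :=
    Finset.sum_equiv e he fun v hv => (hh v hv).symm
  rw [Finset.sum_neg_distrib] at h1
  omega

end Levels

/-! ### Sizes of the level sets, through a quadratic character sum. -/

section LevelSets

variable {K V : Type*} [Field K] [AddCommGroup V] [Module K V] [CharP K 2]

/-- The singular vectors `v` with `B(p, v) = 1` and `f v = t`, where `B` is the polar form. -/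
def level (Q : QuadraticForm K V) (p : V) (f : Module.Dual K V) (t : K) : Set V :=
  {v | QuadraticMap.polar Q p v = 1 ∧ Q v = 0 ∧ f v = t}

omit [CharP K 2] in
lemma map_add_smul_singular {Q : QuadraticForm K V} {p : V} (hp : Q p = 0) (v : V) (t : K) :
    Q (v + t • p) = Q v + t * QuadraticMap.polar Q p v := by
  rw [map_add_smul, hp, mul_zero, add_zero, QuadraticMap.polar_comm]

variable {Q : QuadraticForm K V} {p a : V} {f : Module.Dual K V}

/-- Adding `s • a` changes `Q` by `s² Q a`, as `a` is orthogonal to everything. Adding `s² Q a`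
times `p` cancels this, because `B(p, v) = 1`. The total change of `f` is the value of `sqAddLin` at
`s`. -/
lemma ncard_level_add_le [Finite V] (hp : Q p = 0)
    (hpol : ∀ v, QuadraticMap.polar Q v a = 0) (t s : K) :
    (level Q p f t).ncard ≤ (level Q p f (t + sqAddLin (Q a * f p) (f a) s)).ncard := by
  refine Set.ncard_le_ncard_of_injOn (fun v => (v + s • a) + (s * s * Q a) • p) ?_ ?_
    (Set.toFinite _)
  · rintro v ⟨h1, h2, h3⟩
    have h4 : QuadraticMap.polar Q p (v + s • a) = 1 := by
      rw [QuadraticMap.polar_add_right, QuadraticMap.polar_smul_right, hpol, smul_zero, h1,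
        add_zero]
    refine ⟨?_, ?_, ?_⟩
    · rw [QuadraticMap.polar_add_right, h4, QuadraticMap.polar_smul_right, polar_self_eq_zero,
        smul_zero, add_zero]
    · rw [map_add_smul_singular hp, h4, map_add_smul, hpol, h2, mul_zero, mul_one, zero_add,
        add_zero, CharTwo.add_self_eq_zero]
    · simp only [map_add, map_smul, smul_eq_mul, h3, sqAddLin_apply]
      ring
  · intro v _ w _ h
    exact add_right_cancel (add_right_cancel h)

/-- Shifting twice by the same amount is the identity in characteristic two, so the inequality goes
both ways. -/
lemma ncard_level_add [Finite V] (hp : Q p = 0)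
    (hpol : ∀ v, QuadraticMap.polar Q v a = 0) (t : K) {u : K}
    (hu : u ∈ (sqAddLin (Q a * f p) (f a)).range) :
    (level Q p f (t + u)).ncard = (level Q p f t).ncard := by
  obtain ⟨s, rfl⟩ := hu
  refine le_antisymm ?_ (ncard_level_add_le hp hpol t s)
  have h := ncard_level_add_le (f := f) hp hpol (t + sqAddLin (Q a * f p) (f a) s) s
  rwa [add_assoc, CharTwo.add_self_eq_zero, add_zero] at h

/-- The vectors `v` with `B(p, v) = 1` and prescribed value of `f v + Q v f p` form lines in the
direction `p` that each contain one singular vector. -/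
lemma ncard_level_cone (hp : Q p = 0) (t : K) :
    {v | QuadraticMap.polar Q p v = 1 ∧ f v + Q v * f p = t}.ncard
      = Nat.card K * (level Q p f t).ncard := by
  have hpv {v : V} (hv : QuadraticMap.polar Q p v = 1) (s : K) :
      QuadraticMap.polar Q p (v + s • p) = 1 := by
    rw [QuadraticMap.polar_add_right, QuadraticMap.polar_smul_right, polar_self_eq_zero,
      smul_zero, add_zero, hv]
  have hF {v : V} (hv : QuadraticMap.polar Q p v = 1) (s : K) :
      f (v + s • p) + Q (v + s • p) * f p = f v + Q v * f p := by
    rw [map_add_smul_singular hp, hv, map_add, map_smul, smul_eq_mul]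
    linear_combination s * f p * (CharTwo.two_eq_zero : (2 : K) = 0)
  refine ncard_eq_mul_of_existsUnique (c := p) ?_ ?_ ?_
  · rintro v ⟨h1, h2, h3⟩
    exact ⟨h1, by rw [h2, h3, zero_mul, add_zero]⟩
  · rintro v ⟨h1, h2⟩ s
    exact ⟨hpv h1 s, by rw [hF h1, h2]⟩
  · rintro v ⟨h1, h2⟩
    refine ⟨Q v, ⟨hpv h1 _, ?_, ?_⟩, ?_⟩
    · rw [map_add_smul_singular hp, h1, mul_one, CharTwo.add_self_eq_zero]
    · have h3 := hF h1 (Q v)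
      rwa [map_add_smul_singular hp, h1, mul_one, CharTwo.add_self_eq_zero, zero_mul, add_zero,
        h2] at h3
    · rintro s ⟨-, hs, -⟩
      rw [map_add_smul_singular hp, h1, mul_one] at hs
      exact (CharTwo.add_eq_zero.1 hs).symm

variable [Finite K] [FiniteDimensional K V]

omit [CharP K 2] [Finite K] in
lemma ncard_dual_eq_one {φ : Module.Dual K V} {x : V} (hx : φ x ≠ 0) :
    {v | φ v = 1}.ncard * Nat.card K = Nat.card K ^ Module.finrank K V := by
  have h1 : {v | φ v = 1} = (fun v => v + (φ x)⁻¹ • x) '' (LinearMap.ker φ : Set V) := by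
    ext v
    constructor
    · intro hv
      refine ⟨v - (φ x)⁻¹ • x, ?_, by simp⟩
      have : φ v = 1 := hv
      simp [this, hx]
    · rintro ⟨w, hw, rfl⟩
      have : φ w = 0 := hw
      simp [this, hx]
  rw [h1, Set.ncard_image_of_injective _ (add_left_injective _), ncard_submodule,
    ← Module.Dual.finrank_ker_add_one_of_ne_zero (f := φ) (fun h => hx (by simp [h])), pow_succ]

omit [FiniteDimensional K V] in
open Classical in
/-- A quadratic character sum over an affine hyperplane that does not vanish. -/
lemma charSum_ne_zero [Fintype V] (hQ : Q.radical = ⊥) (hp : Q p = 0) (hp0 : p ≠ 0) (ha : Q a ≠ 0)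
    (hpol : ∀ v, QuadraticMap.polar Q v a = 0) (hfp : f p ≠ 0) (hfa : f a ≠ 0) :
    ∑ v ∈ Finset.univ.filter (fun v => QuadraticMap.polar Q p v = 1),
      signOf (sqAddLin (Q a * f p) (f a)).range (f v + Q v * f p) ≠ 0 := by
  have hG := index_range_sqAddLin (mul_ne_zero ha hfp) hfa
  set G := (sqAddLin (Q a * f p) (f a)).range
  set D := Finset.univ.filter (fun v => QuadraticMap.polar Q p v = 1) with hD
  set W := Finset.univ.filter (fun v => QuadraticMap.polar Q p v = 0) with hW
  have memD (v : V) : v ∈ D ↔ QuadraticMap.polar Q p v = 1 := by simp [hD]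
  have memW (v : V) : v ∈ W ↔ QuadraticMap.polar Q p v = 0 := by simp [hW]
  have hDpos : 0 < (D.card : ℤ) := by
    obtain ⟨w, hw⟩ : ∃ w, QuadraticMap.polar Q p w ≠ 0 := by
      by_contra! h0
      have : p ∈ Q.radical := mem_radical.2 ⟨hp, h0⟩
      rw [hQ] at this
      exact hp0 this
    refine Int.natCast_pos.2 (Finset.card_pos.2 ⟨(QuadraticMap.polar Q p w)⁻¹ • w, ?_⟩)
    rw [memD, QuadraticMap.polar_smul_right, smul_eq_mul, inv_mul_cancel₀ hw]
  set F : V → K := fun v => f v + Q v * f p with hF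
  intro hzero
  -- This is the square of the sum, after substituting `w = v + y` and using `F v + F (v + y) = F y
  -- + B(v, y) f p`.
  have hsq : ∑ y ∈ W, signOf G (F y) * ∑ v ∈ D, signOf G (QuadraticMap.polar Q v y * f p) = 0 := by
    calc _ = ∑ y ∈ W, ∑ v ∈ D, signOf G (F v) * signOf G (F (v + y)) := by
          refine Finset.sum_congr rfl fun y _ => ?_
          rw [Finset.mul_sum]
          refine Finset.sum_congr rfl fun v _ => ?_
          rw [← signOf_add hG, ← signOf_add hG]
          congr 1
          simp only [hF, map_add, QuadraticMap.map_add (⇑Q)]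
          linear_combination (-(f v) - Q v * f p) * (CharTwo.two_eq_zero : (2 : K) = 0)
      _ = ∑ v ∈ D, signOf G (F v) * ∑ w ∈ D, signOf G (F w) := by
          rw [Finset.sum_comm]
          refine Finset.sum_congr rfl fun v hv => ?_
          rw [← Finset.mul_sum]
          congr 1
          refine Finset.sum_equiv (Equiv.addLeft v) (fun y => ?_) fun y _ => rfl
          rw [memD] at hv
          rw [memD, memW, Equiv.coe_addLeft, QuadraticMap.polar_add_right, hv]
          simp
      _ = 0 := by simp [hF, hzero]
  -- The inner sum vanishes unless `y` is orthogonal to all of `W`, that is, unless `y` is in the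
  -- span of `p` and `a`; there every summand is `1`.
  have hterm (y : V) (hy : y ∈ W) :
      0 ≤ signOf G (F y) * ∑ v ∈ D, signOf G (QuadraticMap.polar Q v y * f p) := by
    by_cases hyW : ∀ w ∈ W, QuadraticMap.polar Q w y = 0
    · -- here `y` is orthogonal to the orthogonal space of `p`
      have hspan : ∃ s t : K, y = s • p + t • a := by
        have h1 : QuadraticMap.polarBilin Q y ∈
            Submodule.span K (Set.range fun _ : Unit => QuadraticMap.polarBilin Q p) := by
          refine mem_span_of_iInf_ker_le_ker fun w hw => ?_
          have h2 : QuadraticMap.polar Q p w = 0 := by simpa using hw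
          have h3 := hyW w ((memW w).2 h2)
          rw [QuadraticMap.polar_comm] at h3
          exact h3
        rw [Set.range_const, Submodule.mem_span_singleton] at h1
        obtain ⟨s, hs⟩ := h1
        have h2 : y - s • p ∈ K ∙ a := by
          refine mem_span_of_polar_eq_zero hQ ha hpol fun w => ?_
          have h3 := LinearMap.congr_fun hs w
          simp only [LinearMap.smul_apply, QuadraticMap.polarBilin_apply_apply] at h3
          rw [QuadraticMap.polar_sub_left, QuadraticMap.polar_smul_left, h3, sub_self]
        obtain ⟨t, ht⟩ := Submodule.mem_span_singleton.1 h2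
        exact ⟨s, t, by rw [ht]; abel⟩
      obtain ⟨s, t, rfl⟩ := hspan
      rw [Finset.mul_sum]
      refine Finset.sum_nonneg fun v hv => ?_
      rw [memD] at hv
      rw [← signOf_add hG]
      -- The terms in `s` cancel since `B(v, p) = 1`; what remains is in the range `G`, where the
      -- character is trivial.
      have : F (s • p + t • a) + QuadraticMap.polar Q v (s • p + t • a) * f p
          = sqAddLin (Q a * f p) (f a) t := by
        simp only [hF, map_add_smul, QuadraticMap.map_smul, hp, hpol, map_add, map_smul,
          QuadraticMap.polar_add_right, QuadraticMap.polar_smul_right, smul_eq_mul,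
          sqAddLin_apply, QuadraticMap.polar_comm Q v p, hv]
        linear_combination (s * f p) * (CharTwo.two_eq_zero : (2 : K) = 0)
      rw [this, signOf, if_pos ⟨t, rfl⟩]
      exact zero_le_one
    · push Not at hyW
      obtain ⟨w, hw, hwy⟩ := hyW
      obtain ⟨u, hu⟩ := exists_signOf_eq_neg_one hG
      rw [memW] at hw
      -- Translating `D` by a suitable multiple of `w` changes the sign of each summand.
      have : ∑ v ∈ D, signOf G (QuadraticMap.polar Q v y * f p) = 0 := by
        refine sum_eq_zero_of_shift
          (Equiv.addRight ((u / (QuadraticMap.polar Q w y * f p)) • w)) (fun v => ?_) fun v _ => ?_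
        · rw [memD, memD, Equiv.coe_addRight, QuadraticMap.polar_add_right,
            QuadraticMap.polar_smul_right, hw, smul_zero, add_zero]
        · rw [Equiv.coe_addRight, QuadraticMap.polar_add_left, QuadraticMap.polar_smul_left,
            add_mul, signOf_add hG, smul_eq_mul, mul_assoc, div_mul_cancel₀ _ (mul_ne_zero hwy hfp),
            hu, mul_neg_one]
      rw [this, mul_zero]
  -- The term `y = 0` equals the size of `D`, which is positive.
  have h0W : (0 : V) ∈ W := by rw [memW, QuadraticMap.polar_zero_right]
  have h0 := (Finset.sum_eq_zero_iff_of_nonneg hterm).1 hsq 0 h0W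
  have hF0 : F 0 = 0 := by simp [hF]
  rw [hF0, Finset.sum_congr rfl (g := fun _ => (1 : ℤ)) (fun v _ => by
    rw [QuadraticMap.polar_zero_right, zero_mul, signOf, if_pos G.zero_mem]), signOf,
    if_pos G.zero_mem, one_mul, Finset.sum_const, nsmul_eq_mul, mul_one] at h0
  omega

/-- Among the hyperplanes through a codimension two space that contains neither the vertex `p` of
a tangent hyperplane nor the nucleus, two meet the quadric in different numbers of points outside
the tangent hyperplane, and the mean of these two numbers is known. -/
lemma exists_level_pair {d : ℕ} (hV : Module.finrank K V = d + 2) (hQ : Q.radical = ⊥)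
    (hp : Q p = 0) (hp0 : p ≠ 0) (ha : Q a ≠ 0)
    (hpol : ∀ v, QuadraticMap.polar Q v a = 0) (hfp : f p ≠ 0) (hfa : f a ≠ 0) :
    ∃ t u : K, (level Q p f t).ncard ≠ (level Q p f u).ncard ∧
      Nat.card K * ((level Q p f t).ncard + (level Q p f u).ncard) = 2 * Nat.card K ^ d := by
  classical
  have : Finite V := Module.finite_of_finite K
  have := Fintype.ofFinite V
  have := Fintype.ofFinite K
  have hG := index_range_sqAddLin (mul_ne_zero ha hfp) hfa
  have hGcard := two_mul_card_range_sqAddLin (mul_ne_zero ha hfp) hfa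
  have hsum0 := charSum_ne_zero hQ hp hp0 ha hpol hfp hfa
  have hlev (t : K) {u : K} := ncard_level_add (f := f) hp hpol t (u := u)
  set G := (sqAddLin (Q a * f p) (f a)).range
  set D := Finset.univ.filter (fun v => QuadraticMap.polar Q p v = 1) with hD
  have hfib (t : K) : (D.filter fun v => f v + Q v * f p = t).card
      = Nat.card K * (level Q p f t).ncard := by
    rw [← ncard_level_cone hp, ← Set.ncard_coe_finset]
    congr 1
    ext v
    simp [hD]
  -- If all levels had the same size, the character sum would be a multiple of the sum of a
  -- nontrivial character, hence zero.
  obtain ⟨u, hu⟩ : ∃ u, (level Q p f u).ncard ≠ (level Q p f 0).ncard := by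
    by_contra! hconst
    apply hsum0
    rw [← Finset.sum_fiberwise D (fun v => f v + Q v * f p)]
    obtain ⟨u, hu⟩ := exists_signOf_eq_neg_one hG
    refine sum_eq_zero_of_shift (Equiv.addRight u) (by simp) fun t _ => ?_
    have hin (t : K) : ∑ v ∈ D.filter (fun v => f v + Q v * f p = t),
        signOf G (f v + Q v * f p) = (Nat.card K * (level Q p f 0).ncard : ℕ) * signOf G t := by
      rw [Finset.sum_congr rfl (g := fun _ => signOf G t)
        (fun v hv => by rw [(Finset.mem_filter.1 hv).2]), Finset.sum_const, hfib, hconst,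
        nsmul_eq_mul]
    rw [hin, hin, Equiv.coe_addRight, signOf_add hG, hu]
    ring
  refine ⟨u, 0, hu, ?_⟩
  have huG : u ∉ G := fun h => hu (by rw [← hlev 0 h, zero_add])
  -- Sizes are constant on the two cosets of `G`, so the total over `K` determines their mean.
  have hval (t : K) : (level Q p f t).ncard
      = if t ∈ G then (level Q p f 0).ncard else (level Q p f u).ncard := by
    split_ifs with ht
    · rw [← hlev 0 ht, zero_add]
    · have h1 : u + t ∈ G := by
        rw [AddSubgroup.add_mem_iff_of_index_two hG]
        simp [huG, ht]
      rw [← hlev u h1, ← add_assoc, CharTwo.add_self_eq_zero, zero_add]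
  have hDcard : D.card * Nat.card K = Nat.card K ^ (d + 2) := by
    obtain ⟨w, hw⟩ : ∃ w, QuadraticMap.polarBilin Q p w ≠ 0 := by
      by_contra! h0
      have : p ∈ Q.radical := mem_radical.2 ⟨hp, h0⟩
      rw [hQ] at this
      exact hp0 this
    rw [← hV, ← ncard_dual_eq_one hw, ← Set.ncard_coe_finset]
    congr 2
    ext v
    simp [hD]
  have hsum : ∑ t : K, (level Q p f t).ncard * Nat.card K = D.card := by
    rw [Finset.card_eq_sum_card_fiberwise (f := fun v => f v + Q v * f p) (t := Finset.univ)
      (by simp)]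
    exact Finset.sum_congr rfl fun t _ => by rw [hfib, mul_comm]
  rw [← Finset.sum_mul, Finset.sum_congr rfl fun t _ => hval t, Finset.sum_ite, Finset.sum_const,
    Finset.sum_const, smul_eq_mul, smul_eq_mul] at hsum
  have hin : (Finset.univ.filter (· ∈ G)).card = Nat.card G := by
    rw [Nat.card_eq_fintype_card, Fintype.card_subtype]
  have hout : (Finset.univ.filter (fun t => t ∉ G)).card = Nat.card G := by
    have h1 := Finset.card_filter_add_card_filter_not (s := (Finset.univ : Finset K)) (· ∈ G)
    rw [hin, Finset.card_univ, ← Nat.card_eq_fintype_card] at h1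
    omega
  rw [hin, hout] at hsum
  have hq : 0 < Nat.card K := Nat.card_pos
  refine Nat.eq_of_mul_eq_mul_right (pow_pos hq 2) ?_
  calc _ = 2 * ((Nat.card G * (level Q p f 0).ncard + Nat.card G * (level Q p f u).ncard)
        * Nat.card K * Nat.card K) := by rw [← hGcard]; ring
    _ = _ := by rw [hsum, hDcard]; ring

end LevelSets

/-! ### Switched sets, uniqueness of tangent points and transfer between nuclei. -/

section Switching

variable {K V : Type*} [Field K] [AddCommGroup V] [Module K V]

lemma IsSwitching.mem_vec_iff {S S' : Set (ℙ K V)} {π : Submodule K V}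
    (h : IsSwitching S π S') {v : V} (hv : v ∉ π) : v ∈ vec S' ↔ v ∈ vec S := by
  obtain ⟨R, R', hR, hR', rfl⟩ := h
  constructor
  · rintro ⟨h0, ⟨h1, -⟩ | h1⟩
    · exact ⟨h0, h1⟩
    · exact absurd ((mk_mem_pts h0).1 (hR' h1)) hv
  · rintro ⟨h0, h1⟩
    exact ⟨h0, Or.inl ⟨h1, fun h2 => hv ((mk_mem_pts h0).1 (hR h2))⟩⟩

/-- The nucleus of a parabolic quasi-quadric does not belong to it. -/
lemma IsParabolicQuasiQuadricWithNucleus.nucleus_notMem [Finite K] {m : ℕ} {S : Set (ℙ K V)}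
    {N : ℙ K V} (h : IsParabolicQuasiQuadricWithNucleus (m + 1) ⊤ S N) : N ∉ S := by
  intro hN
  -- A nucleus in `S` would be the only point of `S` on each of its lines.
  have h1 : S = {N} := by
    refine Set.eq_singleton_iff_unique_mem.2 ⟨hN, fun X hX => ?_⟩
    by_contra hne
    have hli := (Projectivization.linearIndependent_pair_iff_ne).2 hne
    have hfin := finrank_span_eq_card hli
    rw [Matrix.range_cons, Matrix.range_cons, Matrix.range_empty, Set.union_empty,
      Set.singleton_union, Fintype.card_fin] at hfin
    have hmem (Y : ℙ K V) (L : Submodule K V) (hY : Y.rep ∈ L) : Y ∈ pts L := by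
      rw [← Projectivization.mk_rep Y, mk_mem_pts]
      exact hY
    have hNL := hmem N (Submodule.span K {X.rep, N.rep}) (Submodule.subset_span (by simp))
    have hXL := hmem X (Submodule.span K {X.rep, N.rep}) (Submodule.subset_span (by simp))
    exact hne ((h.tangent _ le_top hfin hNL).unique ⟨hX, hXL⟩ ⟨hN, hNL⟩)
  have h2 := h.card_eq
  rw [h1, Set.ncard_singleton] at h2
  have hq : 1 < Nat.card K := Finite.one_lt_card
  have h3 := parabolicCard_mul hq (m + 1)
  rw [← h2] at h3
  have h4 : (Nat.card K) ^ 1 < Nat.card K ^ (2 * (m + 1)) := Nat.pow_lt_pow_right hq (by omega)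
  zify at h4
  push_cast at h3
  linarith

lemma IsParabolicQuasiQuadricWithNucleus.ncard_inter_ker [Finite K] [FiniteDimensional K V]
    {m : ℕ} {S : Set (ℙ K V)} {a : V} {ha : a ≠ 0}
    (h : IsParabolicQuasiQuadricWithNucleus (m + 1) ⊤ S (Projectivization.mk K a ha))
    {f : Module.Dual K V} (hf : f a ≠ 0) :
    ((vec S ∩ LinearMap.ker f).ncard : ℤ)
        = (Nat.card K * (Nat.card K : ℤ) ^ m + 1) * ((Nat.card K : ℤ) ^ m - 1) ∨
      ((vec S ∩ LinearMap.ker f).ncard : ℤ)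
        = (Nat.card K * (Nat.card K : ℤ) ^ m - 1) * ((Nat.card K : ℤ) ^ m + 1) := by
  have hq : 1 < Nat.card K := Finite.one_lt_card
  rw [← vec_inter_pts, cast_ncard_vec, ← ellipticCard_mul hq, ← hyperbolicCard_mul hq]
  rcases h.card_hyperplane _ (isHyperplaneOf_ker hf) (by rw [mk_mem_pts]; exact hf) with h1 | h1
  · exact Or.inl (by rw [h1])
  · exact Or.inr (by rw [h1])

/-- Here `Q (v + t • b) = Q v + t² Q b`, and squaring is a bijection of `K`. -/
lemma existsUnique_of_nucleus [Finite K] [CharP K 2] {Q : QuadraticForm K V} {b : V}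
    (hb : Q b ≠ 0) (hpol : ∀ v, QuadraticMap.polar Q v b = 0) (v : V) :
    ∃! t : K, Q (v + t • b) = 0 := by
  obtain ⟨s, hs⟩ := FiniteField.isSquare_of_char_two (ringChar.eq K 2) (Q v / Q b)
  have key (t : K) : Q (v + t • b) = (t + s) ^ 2 * Q b := by
    rw [map_add_smul, hpol, CharTwo.add_sq]
    rw [div_eq_iff hb] at hs
    rw [hs]; ring
  refine ⟨s, by simp only [key, CharTwo.add_self_eq_zero]; simp, fun t ht => ?_⟩
  simp only [key, mul_eq_zero, hb, or_false, pow_eq_zero_iff two_ne_zero] at ht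
  exact CharTwo.add_eq_zero.1 ht

/-- Since `p` is singular, `Q (v + t • p)` is affine in `t`, with nonzero slope. -/
lemma existsUnique_of_vertex [Finite K] [CharP K 2] {Q : QuadraticForm K V} {p : V}
    (hp : Q p = 0) {v : V} (hv : QuadraticMap.polar Q p v ≠ 0) :
    ∃! t : K, Q (v + t • p) = 0 := by
  simp only [map_add_smul_singular hp]
  refine ⟨-(Q v / QuadraticMap.polar Q p v), by field_simp; ring, fun t ht => ?_⟩
  field_simp
  linear_combination ht

/-- If `N'` is a nucleus of `S'`, and the point of `b` in `π` is a nucleus of `S`, where `S` and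
`S'` coincide outside `π`, then lines in `π` through the point of `b` are tangents to `S'` as soon
as `N'` is not in `π`. -/
lemma existsUnique_of_nucleus_off [Finite K] {Y : Set V} {φ : Module.Dual K V} {a b : V}
    (hYsmul : ∀ c : K, c ≠ 0 → ∀ v, c • v ∈ Y ↔ v ∈ Y)
    (hφa : φ a ≠ 0) (hφb : φ b = 0)
    (hb : ∀ v, φ v ≠ 0 → ∃! t : K, v + t • b ∈ Y)
    (ha : ∀ v, v ∉ K ∙ a → ∃! t : K, v + t • a ∈ Y)
    {w : V} (hφw : φ w = 0) (hw : w ∉ K ∙ b) : ∃! t : K, w + t • b ∈ Y := by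
  have hσ (s : K) : ∃! t : K, a + s • w + t • b ∈ Y := hb _ (by simpa [hφw] using hφa)
  choose σ hσ1 hσ2 using hσ
  -- The point `a + s w + σ(s) b` of `Y` projects from `a` to `w + (σ(s) / s) b` on the line in
  -- question.
  have hρ (s : Kˣ) (m : K) :
      σ s / s = m ↔ w + m • b + (s : K)⁻¹ • a ∈ Y := by
    rw [← hYsmul s s.ne_zero, div_eq_iff s.ne_zero, eq_comm]
    have : (s : K) • (w + m • b + (s : K)⁻¹ • a) = a + (s : K) • w + (m * s) • b := by
      rw [smul_add, smul_add, smul_smul, smul_smul, mul_inv_cancel₀ s.ne_zero, one_smul,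
        mul_comm m]
      abel
    rw [this]
    exact ⟨fun h => h ▸ hσ1 s, fun h => hσ2 s _ h⟩
  have hva (m : K) : w + m • b ∉ K ∙ a := by
    intro h
    obtain ⟨t, ht⟩ := Submodule.mem_span_singleton.1 h
    have h1 : φ (t • a) = 0 := by rw [ht]; simp [hφw, hφb]
    rw [map_smul, smul_eq_mul, mul_eq_zero, or_iff_left hφa] at h1
    rw [h1, zero_smul] at ht
    exact hw (Submodule.mem_span_singleton.2 ⟨-m, by
      rw [neg_smul]; exact (eq_neg_of_add_eq_zero_left ht.symm).symm⟩)
  have hinj : Function.Injective fun s : Kˣ => σ s / s := by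
    intro s s' h
    have h1 := (hρ s' _).1 rfl
    have h2 := (hρ s _).1 h
    exact Units.ext (inv_injective ((ha _ (hva _)).unique h2 h1))
  -- Each line through `a` has one point in `Y`: either it is `w + m b` itself or it gives `m = σ(s)
  -- / s`. The `q - 1` ratios are distinct, so exactly one `m` is left.
  have hset : {m : K | w + m • b ∈ Y} = (Set.range fun s : Kˣ => σ s / s)ᶜ := by
    ext m
    rw [Set.mem_ofPred_eq, Set.mem_compl_iff]
    constructor
    · rintro h ⟨s, hs⟩
      have h1 := (ha _ (hva m)).unique (y₂ := 0) ((hρ s m).1 hs) (by simpa using h)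
      exact inv_ne_zero s.ne_zero h1
    · intro h
      obtain ⟨t, ht, -⟩ := ha _ (hva m)
      by_cases ht0 : t = 0
      · simpa [ht0] using ht
      · refine absurd ⟨(Units.mk0 t ht0)⁻¹, (hρ _ m).2 ?_⟩ h
        simpa using ht
  have hcard : {m : K | w + m • b ∈ Y}.ncard = 1 := by
    have h1 := Set.ncard_add_ncard_compl (Set.range fun s : Kˣ => σ s / s)
    rw [← hset, ← Set.image_univ, Set.ncard_image_of_injective _ hinj, Set.ncard_univ,
      Nat.card_units] at h1
    have hq : 1 < Nat.card K := Finite.one_lt_card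
    omega
  obtain ⟨m, hm⟩ := Set.ncard_eq_one.1 hcard
  exact ⟨m, (Set.ext_iff.1 hm m).2 rfl, fun t ht => (Set.ext_iff.1 hm t).1 ht⟩

/-- Scaling normalises `B(p, v)` to `1`, with `q - 1` scalars for each normalised vector. -/
lemma ncard_affine [Finite K] (Q : QuadraticForm K V) (p : V) (f : Module.Dual K V) (t : K) :
    {v | QuadraticMap.polar Q p v ≠ 0 ∧ Q v = 0 ∧ f v = t * QuadraticMap.polar Q p v}.ncard
      = (Nat.card K - 1) * (level Q p f t).ncard := by
  have e : (level Q p f t × Kˣ) ≃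
      {v | QuadraticMap.polar Q p v ≠ 0 ∧ Q v = 0 ∧ f v = t * QuadraticMap.polar Q p v} := by
    refine Equiv.ofBijective (fun x => ⟨(x.2 : K) • (x.1 : V), ?_⟩) ⟨?_, ?_⟩
    · obtain ⟨⟨v, hv⟩, c⟩ := x
      obtain ⟨h1, h2, h3⟩ := id hv
      refine ⟨?_, ?_, ?_⟩ <;> dsimp only
      · rw [QuadraticMap.polar_smul_right, h1]; simp
      · rw [QuadraticMap.map_smul, h2, smul_zero]
      · rw [QuadraticMap.polar_smul_right, h1, map_smul, h3]; simp [mul_comm]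
    · rintro ⟨⟨v, h1, h2, h3⟩, c⟩ ⟨⟨v', h1', h2', h3'⟩, c'⟩ h
      simp only [Subtype.mk.injEq] at h
      have hc := congrArg (QuadraticMap.polar Q p) h
      rw [QuadraticMap.polar_smul_right, QuadraticMap.polar_smul_right, h1, h1', smul_eq_mul,
        smul_eq_mul, mul_one, mul_one] at hc
      obtain rfl := Units.ext hc
      obtain rfl := smul_right_injective V c.ne_zero h
      rfl
    · rintro ⟨v, h1, h2, h3⟩
      refine ⟨(⟨(QuadraticMap.polar Q p v)⁻¹ • v, ?_, ?_, ?_⟩, Units.mk0 _ h1), Subtype.ext ?_⟩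
      · rw [QuadraticMap.polar_smul_right, smul_eq_mul, inv_mul_cancel₀ h1]
      · rw [QuadraticMap.map_smul, h2, smul_zero]
      · rw [map_smul, h3, smul_eq_mul]; field_simp
      · simp [smul_smul, h1]
  rw [← Nat.card_coe_set_eq, ← Nat.card_congr e, Nat.card_prod, Nat.card_coe_set_eq,
    Nat.card_units, mul_comm]

end Switching

/-! ### Position of the new nucleus, and the cone structure of the switched set. -/

section Main

variable {K V : Type*} [Field K] [AddCommGroup V] [Module K V] [Finite K] [CharP K 2]
  [FiniteDimensional K V]

omit [CharP K 2] [FiniteDimensional K V] in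
lemma existsUnique_mem_vec {m : ℕ} {S' : Set (ℙ K V)} {a : V} {ha : a ≠ 0}
    (hS' : IsParabolicQuasiQuadricWithNucleus (m + 1) ⊤ S' (Projectivization.mk K a ha))
    (v : V) (hv : v ∉ K ∙ a) : ∃! t : K, v + t • a ∈ vec S' :=
  hS'.tangent.existsUnique trivial (fun h => hS'.nucleus_notMem h.2) trivial hv

omit [CharP K 2] in
/-- A parabolic quasi-quadric has only one nucleus. -/
lemma mem_span_of_two_nuclei {m : ℕ} {S' : Set (ℙ K V)} {a b : V} {ha : a ≠ 0}
    (hS' : IsParabolicQuasiQuadricWithNucleus (m + 1) ⊤ S' (Projectivization.mk K a ha))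
    (hb0 : b ≠ 0) (hbS : b ∉ vec S') (hb : ∀ v, v ∉ K ∙ b → ∃! t : K, v + t • b ∈ vec S') :
    a ∈ K ∙ b := by
  by_contra hab
  have hq : 1 < Nat.card K := Finite.one_lt_card
  obtain ⟨f, hf, hfa⟩ := exists_dual_ne_zero hab
  have hfb : f b = 0 := hf (Submodule.mem_span_singleton_self b)
  -- Tangents through `b` fix the size of a hyperplane containing `b` but not `a`; it lies strictly
  -- between the two allowed sizes.
  have h1 := ncard_of_tangents (Y := vec S' ∩ LinearMap.ker f) (W := LinearMap.ker f) hb0 hfb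
    (by
      rintro v ⟨hv, hvf⟩
      refine ⟨hvf, fun h => hbS ?_⟩
      obtain ⟨t, rfl⟩ := Submodule.mem_span_singleton.1 h
      exact (smul_mem_vec fun h0 => ne_zero_of_mem_vec hv (by simp [h0])).1 hv)
    (by
      intro w hw hwb
      obtain ⟨t, ht, huniq⟩ := hb w hwb
      exact ⟨t, ⟨ht, Submodule.add_mem _ hw (Submodule.smul_mem _ _ hfb)⟩,
        fun s hs => huniq s hs.1⟩)
  have h2 := (isHyperplaneOf_ker hfa).2
  rw [hS'.finrank_eq] at h2
  rw [show Module.finrank K (LinearMap.ker f) = 2 * m + 1 + 1 by omega] at h1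
  zify at h1
  set q : ℤ := (Nat.card K : ℤ) with hqdef
  have hq1 : (1 : ℤ) < q := by rw [hqdef]; exact_mod_cast hq
  have hq0 : q ≠ 0 := by omega
  have hr0 : q ^ m ≠ 0 := pow_ne_zero _ hq0
  have h3 : ((vec S' ∩ LinearMap.ker f).ncard : ℤ) = q * q ^ m * q ^ m - 1 := by
    refine mul_left_cancel₀ hq0 ?_
    rw [pow_succ, pow_succ, pow_mul'] at h1
    linear_combination h1
  have h4 : q ^ m * (q - 1) = 0 := by
    rcases hS'.ncard_inter_ker hfa with h | h
    · rw [h3] at h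
      linear_combination h
    · rw [h3] at h
      linear_combination -h
  rcases mul_eq_zero.1 h4 with h | h
  · exact hr0 h
  · omega

variable {Q : QuadraticForm K V} {S' : Set (ℙ K V)} {p b a c : V} {ha : a ≠ 0} {hc : c ≠ 0} {k : ℕ}

/-- The nucleus of the switched set lies in `π`. -/
lemma polar_nucleus_eq_zero
    (hsw : ∀ v, QuadraticMap.polar Q p v ≠ 0 → (v ∈ vec S' ↔ Q v = 0))
    (hb0 : b ≠ 0) (hb : Q b ≠ 0) (hpol : ∀ v, QuadraticMap.polar Q v b = 0) {m : ℕ}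
    (hS' : IsParabolicQuasiQuadricWithNucleus (m + 1) ⊤ S' (Projectivization.mk K a ha)) :
    QuadraticMap.polar Q p a = 0 := by
  by_contra hφa
  have hstar := existsUnique_mem_vec hS'
  have hoff (v : V) (hv : QuadraticMap.polar Q p v ≠ 0) : ∃! t : K, v + t • b ∈ vec S' := by
    have h1 (t : K) : v + t • b ∈ vec S' ↔ Q (v + t • b) = 0 := by
      refine hsw _ ?_
      rwa [QuadraticMap.polar_add_right, QuadraticMap.polar_smul_right, hpol, smul_zero, add_zero]
    simp only [h1]
    exact existsUnique_of_nucleus hb hpol v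
  have hba : b ∉ K ∙ a := by
    intro h
    obtain ⟨t, rfl⟩ := Submodule.mem_span_singleton.1 h
    have h1 := hpol p
    rw [QuadraticMap.polar_smul_right, smul_eq_mul, mul_eq_zero, or_iff_left hφa] at h1
    exact hb0 (by simp [h1])
  -- The line joining `a` and `b` has a point of `S'` other than that of `b`, and it is a tangent
  -- through `a`.
  have hbS : b ∉ vec S' := by
    intro hbS
    obtain ⟨t, ht, -⟩ := hoff a hφa
    have ht0 : t ≠ 0 := by
      rintro rfl
      rw [zero_smul, add_zero] at ht
      exact hS'.nucleus_notMem ht.2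
    have h1 : b + t⁻¹ • a ∈ vec S' := by
      rw [← smul_mem_vec ht0, smul_add, smul_smul, mul_inv_cancel₀ ht0, one_smul, add_comm]
      exact ht
    exact inv_ne_zero ht0 ((hstar b hba).unique (y₂ := 0) h1 (by simpa using hbS))
  have hab := mem_span_of_two_nuclei hS' hb0 hbS fun v hv => by
    by_cases hφv : QuadraticMap.polar Q p v = 0
    · exact existsUnique_of_nucleus_off (φ := QuadraticMap.polarBilin Q p)
        (fun c hc v => smul_mem_vec hc) hφa (hpol p) hoff hstar hφv hv
    · exact hoff v hφv
  obtain ⟨t, rfl⟩ := Submodule.mem_span_singleton.1 hab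
  exact hφa (by rw [QuadraticMap.polar_smul_right, hpol, smul_zero])

omit [FiniteDimensional K V] in
/-- The nucleus of the switched set is the nucleus of the quadric or the vertex. -/
lemma nucleus_mem_span
    (hsw : ∀ v, QuadraticMap.polar Q p v ≠ 0 → (v ∈ vec S' ↔ Q v = 0))
    (hQ : Q.radical = ⊥) (hp : Q p = 0) (hp0 : p ≠ 0)
    (hb : Q b ≠ 0) (hpol : ∀ v, QuadraticMap.polar Q v b = 0) {m : ℕ}
    (hS' : IsParabolicQuasiQuadricWithNucleus (m + 1) ⊤ S' (Projectivization.mk K a ha))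
    (hφa : QuadraticMap.polar Q p a = 0) : a ∈ K ∙ b ∨ a ∈ K ∙ p := by
  obtain ⟨r, hr⟩ : ∃ r, QuadraticMap.polar Q p r ≠ 0 := by
    by_contra! h0
    have : p ∈ Q.radical := mem_radical.2 ⟨hp, h0⟩
    rw [hQ] at this
    exact hp0 this
  have hoff (v : V) (hv : QuadraticMap.polar Q p v ≠ 0) : ∃! t : K, Q (v + t • a) = 0 := by
    have h1 (t : K) : v + t • a ∈ vec S' ↔ Q (v + t • a) = 0 := by
      refine hsw _ ?_
      rwa [QuadraticMap.polar_add_right, QuadraticMap.polar_smul_right, hφa, smul_zero, add_zero]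
    have h2 := existsUnique_mem_vec hS' v fun h => hv (by
      obtain ⟨t, rfl⟩ := Submodule.mem_span_singleton.1 h
      rw [QuadraticMap.polar_smul_right, hφa, smul_zero])
    simpa only [h1] using h2
  by_cases hQa : Q a = 0
  · right
    -- If `B(a, v) = 0`, then `Q` is constant along `v + t • a`, so the root cannot be unique.
    have hker (v : V) (hv : QuadraticMap.polar Q a v = 0) : QuadraticMap.polar Q p v = 0 := by
      by_contra hφv
      have h1 := hoff v hφv
      simp only [map_add_smul_singular hQa, hv, mul_zero, add_zero] at h1
      obtain ⟨t, ht, -⟩ := id h1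
      exact one_ne_zero (h1.unique (y₁ := (1 : K)) (y₂ := 0) ht ht)
    have h1 : QuadraticMap.polarBilin Q p ∈
        Submodule.span K (Set.range fun _ : Unit => QuadraticMap.polarBilin Q a) := by
      refine mem_span_of_iInf_ker_le_ker fun w hw => hker w ?_
      simpa using hw
    rw [Set.range_const, Submodule.mem_span_singleton] at h1
    obtain ⟨s, hs⟩ := h1
    have h2 : p - s • a ∈ K ∙ b := by
      refine mem_span_of_polar_eq_zero hQ hb hpol fun w => ?_
      have h3 := LinearMap.congr_fun hs w
      simp only [LinearMap.smul_apply, QuadraticMap.polarBilin_apply_apply] at h3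
      rw [QuadraticMap.polar_sub_left, QuadraticMap.polar_smul_left, h3, sub_self]
    obtain ⟨t, ht⟩ := Submodule.mem_span_singleton.1 h2
    have hpe : p = s • a + t • b := by rw [ht]; abel
    have ht0 : t = 0 := by
      have h3 := hp
      rw [hpe, map_add_smul, hpol, QuadraticMap.map_smul, hQa, smul_zero, zero_add, mul_zero,
        add_zero, mul_eq_zero, or_iff_left hb, mul_self_eq_zero] at h3
      exact h3
    rw [ht0, zero_smul, add_zero] at hpe
    have hs0 : s ≠ 0 := fun h0 => hp0 (by rw [hpe, h0, zero_smul])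
    exact Submodule.mem_span_singleton.2
      ⟨s⁻¹, by rw [hpe, smul_smul, inv_mul_cancel₀ hs0, one_smul]⟩
  · left
    refine mem_span_of_polar_eq_zero hQ hb hpol fun w => ?_
    rw [QuadraticMap.polar_comm]
    by_cases hw : QuadraticMap.polar Q p w = 0
    -- For `w` in `π`, both `w + r` and `r` are off `π`, and the polar form is additive.
    · have h1 := polar_eq_zero_of_existsUnique hQa (hoff (w + r) (by
        rwa [QuadraticMap.polar_add_right, hw, zero_add]))
      rwa [QuadraticMap.polar_add_left, polar_eq_zero_of_existsUnique hQa (hoff r hr),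
        add_zero] at h1
    · exact polar_eq_zero_of_existsUnique hQa (hoff w hw)

omit [CharP K 2] [FiniteDimensional K V] in
-- All hyperplanes of the pencil share their trace on `π`, so only the second summand depends on
-- `t`.
lemma ncard_vec_inter_ker_split [Finite V]
    (hsw : ∀ v, QuadraticMap.polar Q p v ≠ 0 → (v ∈ vec S' ↔ Q v = 0)) (f : Module.Dual K V)
    (t : K) :
    (vec S' ∩ LinearMap.ker (f - t • QuadraticMap.polarBilin Q p)).ncard
      = (vec S' ∩ LinearMap.ker (QuadraticMap.polarBilin Q p) ∩ LinearMap.ker f).ncard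
        + (Nat.card K - 1) * (level Q p f t).ncard := by
  rw [← ncard_affine, ← Set.ncard_union_eq _ (Set.toFinite _) (Set.toFinite _)]
  · congr 1
    ext v
    simp only [Set.mem_inter_iff, SetLike.mem_coe, LinearMap.mem_ker, LinearMap.sub_apply,
      LinearMap.smul_apply, QuadraticMap.polarBilin_apply_apply, smul_eq_mul, Set.mem_union,
      Set.mem_ofPred_eq, sub_eq_zero]
    by_cases hv : QuadraticMap.polar Q p v = 0
    · simp [hv]
    · simp [hv, hsw v hv]
  · refine Set.disjoint_left.2 ?_
    rintro v ⟨⟨-, h1⟩, -⟩ ⟨h2, -⟩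
    exact h2 h1

omit [CharP K 2] in
/-- The conclusion for a switched set whose nucleus is the point of `a`, where the points of `a`
and `c` are the nucleus and the vertex, in any order. -/
theorem isCone_and_bases_of_switching
    (hV : Module.finrank K V = 2 * (k + 2) + 1)
    (hsw : ∀ v, QuadraticMap.polar Q p v ≠ 0 → (v ∈ vec S' ↔ Q v = 0))
    (hS' : IsParabolicQuasiQuadricWithNucleus (k + 2) ⊤ S' (Projectivization.mk K a ha))
    {π : Submodule K V} (hπ : π = LinearMap.ker (QuadraticMap.polarBilin Q p))
    (hφ : QuadraticMap.polarBilin Q p ≠ 0)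
    (hφa : QuadraticMap.polar Q p a = 0) (hφc : QuadraticMap.polar Q p c = 0)
    (hcoff : ∀ v, QuadraticMap.polar Q p v ≠ 0 → ∃! t : K, Q (v + t • c) = 0)
    (hlevel : ∀ f : Module.Dual K V, f a ≠ 0 → f c ≠ 0 →
      ∃ t u : K, (level Q p f t).ncard ≠ (level Q p f u).ncard ∧
        Nat.card K * ((level Q p f t).ncard + (level Q p f u).ncard)
          = 2 * Nat.card K ^ (2 * (k + 1) + 1)) :
    IsCone π (S' ∩ pts π) (Projectivization.mk K c hc) ∧
      ∀ μ : Submodule K V, IsHyperplaneOf μ π → Projectivization.mk K a ha ∈ pts μ →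
        Projectivization.mk K c hc ∉ pts μ →
        IsConeWithBase π (S' ∩ pts π) (Projectivization.mk K c hc) μ (S' ∩ pts μ) ∧
          IsParabolicQuasiQuadricWithNucleus (k + 2 - 1) μ (S' ∩ pts μ)
            (Projectivization.mk K a ha) := by
  have : Finite V := Module.finite_of_finite K
  have hq : 1 < Nat.card K := Finite.one_lt_card
  have hq1 : (1 : ℤ) < Nat.card K := by exact_mod_cast hq
  have hq0 : (Nat.card K : ℤ) ≠ 0 := by omega
  have hstar := existsUnique_mem_vec hS'
  have hπfin : Module.finrank K π = 2 * (k + 2) := by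
    have := Module.Dual.finrank_ker_add_one_of_ne_zero hφ
    rw [hπ]
    omega
  have haπ : a ∈ π := by rw [hπ]; exact hφa
  have hcπ : c ∈ π := by rw [hπ]; exact hφc
  have hvec : vec (S' ∩ pts π) = vec S' ∩ LinearMap.ker (QuadraticMap.polarBilin Q p) := by
    rw [vec_inter_pts, hπ]
  have htancount (W : Submodule K V) (haW : a ∈ W) (hWπ : W ≤ π) :
      Nat.card K * (vec (S' ∩ pts π) ∩ W).ncard + Nat.card K
        = Nat.card K ^ Module.finrank K W := by
    refine ncard_of_tangents ha haW ?_ ?_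
    · rintro v ⟨hv, hvW⟩
      refine ⟨hvW, fun h => ?_⟩
      obtain ⟨t, rfl⟩ := Submodule.mem_span_singleton.1 h
      rw [smul_mem_vec fun h0 => ne_zero_of_mem_vec hv (by simp [h0])] at hv
      exact hS'.nucleus_notMem hv.2.1
    · intro w hw hwa
      obtain ⟨t, ht, huniq⟩ := hstar w hwa
      refine ⟨t, ⟨?_, W.add_mem hw (W.smul_mem _ haW)⟩, fun s hs => huniq s ?_⟩
      · rw [vec_inter_pts]
        exact ⟨ht, hWπ (W.add_mem hw (W.smul_mem _ haW))⟩
      · have := hs.1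
        rw [vec_inter_pts] at this
        exact this.1
  have hinter (f : Module.Dual K V) : vec (S' ∩ pts π) ∩ (π ⊓ LinearMap.ker f : Submodule K V)
      = vec (S' ∩ pts π) ∩ LinearMap.ker f := by
    rw [vec_inter_pts]
    ext v
    exact ⟨fun h => ⟨h.1, h.2.2⟩, fun h => ⟨h.1, h.1.2, h.2⟩⟩
  have hcard : ((vec (S' ∩ pts π)).ncard : ℤ)
      = Nat.card K * ((Nat.card K : ℤ) ^ (k + 1)) ^ 2 - 1 := by
    have h1 := htancount π haπ le_rfl
    rw [hπfin, Set.inter_eq_left.2 (by rw [vec_inter_pts]; exact Set.inter_subset_right)] at h1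
    zify at h1
    refine mul_left_cancel₀ hq0 ?_
    linear_combination h1
  have hoff (f : Module.Dual K V) (hfc : f c ≠ 0) :
      ((vec (S' ∩ pts π) ∩ LinearMap.ker f).ncard : ℤ)
        = ((Nat.card K : ℤ) ^ (k + 1)) ^ 2 - 1 := by
    by_cases hfa : f a = 0
    · have h1 := htancount (π ⊓ LinearMap.ker f) ⟨haπ, hfa⟩ inf_le_left
      have h2 := finrank_inf_ker_add_one hcπ hfc
      rw [hinter, show Module.finrank K (π ⊓ LinearMap.ker f : Submodule K V) = 2 * (k + 1) + 1
        by omega] at h1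
      zify at h1
      refine mul_left_cancel₀ hq0 ?_
      linear_combination h1
    -- The two hyperplanes of the pencil have different sizes, hence one of each allowed kind.
    -- Adding the sizes and subtracting the parts off `π` gives twice the common trace.
    · obtain ⟨t, u, hne, hsum⟩ := hlevel f hfa hfc
      have hval (t : K) := hS'.ncard_inter_ker
        (f := f - t • QuadraticMap.polarBilin Q p) (by simpa [hφa] using hfa)
      have ht := hval t
      have hu := hval u
      rw [ncard_vec_inter_ker_split hsw, ← hvec] at ht hu
      push_cast [hq.le] at ht hu
      zify at hsum hne
      set q : ℤ := (Nat.card K : ℤ)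
      set w : ℤ := ((vec (S' ∩ pts π) ∩ LinearMap.ker f).ncard : ℤ)
      set x : ℤ := ((level Q p f t).ncard : ℤ)
      set y : ℤ := ((level Q p f u).ncard : ℤ)
      have hxy : x + y = 2 * (q ^ (k + 1)) ^ 2 := by
        refine mul_left_cancel₀ hq0 ?_
        rw [hsum]; ring
      have hne' (h : (q - 1) * x = (q - 1) * y) : False :=
        hne (mul_left_cancel₀ (by omega) h)
      have hw : 2 * w = 2 * ((q ^ (k + 1)) ^ 2 - 1) := by
        rcases ht with ht | ht <;> rcases hu with hu | hu
        · exact (hne' (by linarith)).elim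
        · linear_combination ht + hu - (q - 1) * hxy
        · linear_combination ht + hu - (q - 1) * hxy
        · exact (hne' (by linarith)).elim
      linarith
  have hon (f : Module.Dual K V) (hfa : f a ≠ 0) (hfc : f c = 0) :
      ((vec (S' ∩ pts π) ∩ LinearMap.ker f).ncard : ℤ) = ((Nat.card K : ℤ) ^ (k + 1)) ^ 2 - 1
          - (Nat.card K - 1) * (Nat.card K : ℤ) ^ (k + 1) ∨
      ((vec (S' ∩ pts π) ∩ LinearMap.ker f).ncard : ℤ) = ((Nat.card K : ℤ) ^ (k + 1)) ^ 2 - 1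
          + (Nat.card K - 1) * (Nat.card K : ℤ) ^ (k + 1) := by
    have h0 := hS'.ncard_inter_ker hfa
    have h1 := ncard_vec_inter_ker_split hsw f 0
    rw [zero_smul, sub_zero, ← hvec, ← ncard_affine] at h1
    -- Lines through `c` in `ker f` that leave `π` have one singular point each off `π`. This fixes
    -- the part off `π`, so the two allowed sizes give two values for the trace.
    have h2 : ((LinearMap.ker f : Set V) \ (π ⊓ LinearMap.ker f : Submodule K V)).ncard
        = Nat.card K * {v | QuadraticMap.polar Q p v ≠ 0 ∧ Q v = 0 ∧
          f v = 0 * QuadraticMap.polar Q p v}.ncard := by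
      have hmem (v : V) : v ∈ (LinearMap.ker f : Set V) \ (π ⊓ LinearMap.ker f : Submodule K V)
          ↔ f v = 0 ∧ QuadraticMap.polar Q p v ≠ 0 := by
        rw [hπ]
        constructor
        · rintro ⟨h1, h2⟩
          exact ⟨h1, fun h => h2 ⟨h, h1⟩⟩
        · rintro ⟨h1, h2⟩
          exact ⟨h1, fun h => h2 h.1⟩
      have hadd (v : V) (t : K) : QuadraticMap.polar Q p (v + t • c) = QuadraticMap.polar Q p v := by
        rw [QuadraticMap.polar_add_right, QuadraticMap.polar_smul_right, hφc, smul_zero, add_zero]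
      have hfadd (v : V) (t : K) : f (v + t • c) = f v := by
        rw [map_add, map_smul, hfc, smul_zero, add_zero]
      refine ncard_eq_mul_of_existsUnique (c := c) ?_ ?_ ?_
      · rintro v ⟨h1, -, h3⟩
        exact (hmem v).2 ⟨by simpa using h3, h1⟩
      · intro v hv t
        rw [hmem] at hv ⊢
        rwa [hadd, hfadd]
      · intro v hv
        rw [hmem] at hv
        obtain ⟨t, ht, huniq⟩ := hcoff v hv.2
        refine ⟨t, ⟨by rw [hadd]; exact hv.2, ht, by rw [hfadd, hv.1, zero_mul]⟩, fun s hs => ?_⟩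
        exact huniq s hs.2.1
    have h3 := ncard_diff_submodule (K := K) (inf_le_right : π ⊓ LinearMap.ker f ≤ LinearMap.ker f)
    have h4 := finrank_inf_ker_add_one haπ hfa
    have h5 := (isHyperplaneOf_ker hfa).2
    rw [finrank_top] at h5
    rw [h2, show Module.finrank K (π ⊓ LinearMap.ker f : Submodule K V) = 2 * (k + 1) + 1 by omega,
      show Module.finrank K (LinearMap.ker f) = 2 * (k + 1) + 2 by omega] at h3
    rw [h1] at h0
    zify at h0 h3
    have h6 : ({v | QuadraticMap.polar Q p v ≠ 0 ∧ Q v = 0 ∧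
          f v = 0 * QuadraticMap.polar Q p v}.ncard : ℤ)
        = (Nat.card K - 1) * ((Nat.card K : ℤ) ^ (k + 1)) ^ 2 := by
      refine mul_left_cancel₀ hq0 ?_
      linear_combination h3
    rw [h6] at h0
    rcases h0 with h | h
    · left; linear_combination h
    · right; linear_combination h
  have htan : OnlyTangentsThrough π (S' ∩ pts π) (Projectivization.mk K a ha) := by
    intro L hL hL2 haL
    have h2 : S' ∩ pts π ∩ pts L = S' ∩ pts L := by
      ext x
      exact ⟨fun h => ⟨h.1.1, h.2⟩, fun h => ⟨⟨h.1, le_trans h.2 hL⟩, h.2⟩⟩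
    rw [h2]
    exact hS'.tangent L le_top hL2 haL
  obtain ⟨hcone, hbase⟩ := isCone_and_bases (hc := hc) hπfin Set.inter_subset_right hcπ hcard hoff
    hon htan
  refine ⟨hcone, fun μ hμ haμ hcμ => ?_⟩
  have h2 : S' ∩ pts π ∩ pts μ = S' ∩ pts μ := by
    ext x
    exact ⟨fun h => ⟨h.1.1, h.2⟩, fun h => ⟨⟨h.1, le_trans h.2 hμ.1⟩, h.2⟩⟩
  have h3 := hbase μ hμ haμ hcμ
  rwa [h2] at h3

end Main

end QuasiQuadric

theorem mainTheorem9 {K V : Type*} [Field K] [Finite K] [AddCommGroup V] [Module K V]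
    (hq : Even (Nat.card K)) (n : ℕ) (hn : 1 < n)
    (S : Set (ℙ K V)) (hS : QuasiQuadric.IsParabolicQuadric n S)
    (N : ℙ K V) (hN : QuasiQuadric.IsNucleus S N)
    (π : Submodule K V) (P : ℙ K V)
    (hπ : QuasiQuadric.IsSingularHyperplaneWithVertex n S π P)
    (S' : Set (ℙ K V)) (hswitch : QuasiQuadric.IsSwitching S π S')
    (N' : ℙ K V)
    (hS' : QuasiQuadric.IsParabolicQuasiQuadricWithNucleus n ⊤ S' N') :
    (N' = N ∧ QuasiQuadric.IsCone π (S' ∩ QuasiQuadric.pts π) P ∧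
      ∀ μ : Submodule K V, QuasiQuadric.IsHyperplaneOf μ π →
        N ∈ QuasiQuadric.pts μ → P ∉ QuasiQuadric.pts μ →
        QuasiQuadric.IsConeWithBase π (S' ∩ QuasiQuadric.pts π) P μ
            (S' ∩ QuasiQuadric.pts μ) ∧
          QuasiQuadric.IsParabolicQuasiQuadricWithNucleus (n - 1) μ
            (S' ∩ QuasiQuadric.pts μ) N) ∨
    (N' = P ∧ QuasiQuadric.IsCone π (S' ∩ QuasiQuadric.pts π) N ∧
      ∀ μ : Submodule K V, QuasiQuadric.IsHyperplaneOf μ π →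
        P ∈ QuasiQuadric.pts μ → N ∉ QuasiQuadric.pts μ →
        QuasiQuadric.IsConeWithBase π (S' ∩ QuasiQuadric.pts π) N μ
            (S' ∩ QuasiQuadric.pts μ) ∧
          QuasiQuadric.IsParabolicQuasiQuadricWithNucleus (n - 1) μ
            (S' ∩ QuasiQuadric.pts μ) P) := by
  obtain ⟨k, rfl⟩ : ∃ k, n = k + 2 := ⟨n - 2, by omega⟩
  obtain ⟨hV, Q, hQ, rfl⟩ := hS
  have : FiniteDimensional K V := Module.finite_of_finrank_pos (by omega)
  have : CharP K 2 := by
    have := Fintype.ofFinite K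
    refine ringChar.of_eq (FiniteField.even_card_iff_char_two.2 ?_)
    rw [← Nat.card_eq_fintype_card]
    exact Nat.even_iff.1 hq
  induction N using Projectivization.ind with
  | h b hb0 =>
  induction P using Projectivization.ind with
  | h p hp0 =>
  induction N' using Projectivization.ind with
  | h a ha =>
  obtain ⟨hb, hpol⟩ := hN.polar_eq_zero
  obtain ⟨hp, hπeq⟩ := hπ.eq_ker hV hQ
  have hsw (v : V) (hv : QuadraticMap.polar Q p v ≠ 0) :
      v ∈ QuasiQuadric.vec S' ↔ Q v = 0 := by
    rw [hswitch.mem_vec_iff fun h => hv (by rw [hπeq] at h; exact h), QuasiQuadric.vec_quadric]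
    exact ⟨fun h => h.2, fun h => ⟨fun h0 => hv (by rw [h0, QuadraticMap.polar_zero_right]), h⟩⟩
  have hφ : QuadraticMap.polarBilin Q p ≠ 0 := by
    intro h0
    have : p ∈ Q.radical := QuasiQuadric.mem_radical.2 ⟨hp, LinearMap.congr_fun h0⟩
    rw [hQ] at this
    exact hp0 this
  have hφp := QuasiQuadric.polar_self_eq_zero Q p
  have hφa := QuasiQuadric.polar_nucleus_eq_zero hsw hb0 hb hpol hS'
  have hlevel (f : Module.Dual K V) := QuasiQuadric.exists_level_pair (f := f)
    (d := 2 * (k + 1) + 1) (by omega) hQ hp hp0 hb hpol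
  rcases QuasiQuadric.nucleus_mem_span hsw hQ hp hp0 hb hpol hS' hφa with hab | hap
  -- The two cases differ only by exchanging nucleus and vertex; `hlevel` is symmetric in them.
  · left
    have hN'N : Projectivization.mk K a ha = Projectivization.mk K b hb0 :=
      (Projectivization.mk_eq_mk_iff' K _ _ _ _).2 (Submodule.mem_span_singleton.1 hab)
    rw [hN'N] at hS'
    exact ⟨hN'N, QuasiQuadric.isCone_and_bases_of_switching hV hsw hS' hπeq hφ (hpol p) hφp
      (fun v hv => QuasiQuadric.existsUnique_of_vertex hp hv)
      fun f hfb hfp => hlevel f hfp hfb⟩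
  · right
    have hN'P : Projectivization.mk K a ha = Projectivization.mk K p hp0 :=
      (Projectivization.mk_eq_mk_iff' K _ _ _ _).2 (Submodule.mem_span_singleton.1 hap)
    rw [hN'P] at hS'
    exact ⟨hN'P, QuasiQuadric.isCone_and_bases_of_switching hV hsw hS' hπeq hφ hφp (hpol p)
      (fun v _ => QuasiQuadric.existsUnique_of_nucleus hb hpol v)
      fun f hfp hfb => hlevel f hfp hfb⟩
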